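/- For $t\ge 0$ and $\alpha>-1$ let $w(x;t,\alpha)=x^{\alpha}e^{-x-t/x}$, $x>0$, and let $P_n(x;t,\alpha)$, $n\ge 0$, be the monic orthogonal polynomials of this weight: $P_n$ is monic of degree $n$ and $\int_0^\infty P_jP_kw\,dx=h_j\delta_{jk}$ with $h_j>0$. They satisfy $$xP_n=P_{n+1}+\alpha_nP_n+\beta_nP_{n-1}\quad(n\ge 0,\ \beta_0P_{-1}=0),$$ where $\alpha_n=\alpha_n(t,\alpha)=\frac1{h_n}\int_0^\infty xP_n^2w\,dx$ for $n\ge0$ and $\beta_n=\beta_n(t,\alpha)=\frac1{h_{n-1}}\int_0^\infty xP_nP_{n-1}w\,dx$ for $n\ge 1$. Let $x_{1,n}\le\dots\le x_{n,n}$ denote the zeros of $P_n(x;t,\alpha)$, $n\ge1$. Then: (i) For $n\ge 1$ the zeros of $P_n$ are real, simple and positive, and they interlace with those of $P_{n-1}$: $$0<x_{1,n}<x_{1,n-1}<x_{2,n}<\dots<x_{n-1,n}<x_{n-1,n-1}<x_{n,n}.$$ (ii) For $1\le j\le n$ the zero $x_{j,n}$ is strictly increasing in $\alpha\in(-1,\infty)$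 for each fixed $t\ge 0$, and strictly increasing in $t\in[0,\infty)$ for each fixed $\alpha>-1$. (iii) For $n\ge 2$, $$x_{1,n}<\alpha_{n-1}<x_{n,n}.$$ Moreover, for $n\ge2$ and $\varepsilon\ge0$ put $c_n=4\cos^2\!\left(\frac{\pi}{n+1}\right)+\varepsilon$ and $$y_k^{\pm}=\tfrac12(\alpha_k+\alpha_{k-1})\pm\tfrac12\sqrt{(\alpha_k-\alpha_{k-1})^2+4c_n\beta_k}\quad(1\le k\le n-1),\qquad a_n=\min_{1\le k\le n-1}y_k^-,\qquad b_n=\max_{1\le k\le n-1}y_k^+.$$ Then $a_n\le x_{1,n}$ and $x_{n,n}\le b_n$. The first inequality is strict unless $\varepsilon=0$ and $y_1^-=\dots=y_{n-1}^-$, and the second is strict unless $\varepsilon=0$ and $y_1^+=\dots=y_{n-1}^+$; in particular $a_n<x_{1,n}$ and $x_{n,n}<b_n$ whenever $\varepsilon>0$. (iv) For $n\ge 2$, $$0<x_{1,n}<\alpha_{n-1}+\frac{d_n\beta_{n-1}}{e_n}<x_{n,n},$$ where $$d_n=\frac{P_n(0;t,\alpha)}{P_{n-1}(0;t,\alpha)}+\frac{P_{n-1}(0;t,\alpha+1)}{P_{n-2}(0;t,\alpha+1)},\qquad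 e_n=\frac{P_{n-1}(0;t,\alpha)}{P_{n-2}(0;t,\alpha)}\cdot\frac{P_{n-1}(0;t,\alpha+1)}{P_{n-2}(0;t,\alpha+1)}.$$ -/

import Mathlib

open Polynomial

noncomputable section

namespace SPLaguerre

/-- The weight `w(x; t, α) = x ^ α * exp (-x - t / x)`, used for `x > 0` only. -/
def weight (t α x : ℝ) : ℝ := x ^ α * Real.exp (-x - t / x)

/-- `∫₀^∞ p(x) q(x) w(x) dx`. -/
def inner (w : ℝ → ℝ) (p q : ℝ[X]) : ℝ :=
  ∫ x in Set.Ioi (0 : ℝ), p.eval x * q.eval x * w x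

/-- The monic orthogonal polynomials of a weight on `(0, ∞)`, by the Gram-Schmidt process applied to
`1, X, X ^ 2, …` (without normalization). -/
def monicOP (w : ℝ → ℝ) (n : ℕ) : ℝ[X] :=
  X ^ n - ∑ k : Fin n,
    C (inner w (X ^ n) (monicOP w k) / inner w (monicOP w k) (monicOP w k)) * monicOP w k
termination_by n
decreasing_by exact k.2

/-- `P_n(x; t, α)`. -/
def P (n : ℕ) (t α : ℝ) : ℝ[X] := monicOP (weight t α) n

/-- `h_n(t, α) = ∫₀^∞ P_n² w dx`. -/
def h (n : ℕ) (t α : ℝ) : ℝ := inner (weight t α) (P n t α) (P n t α)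

/-- The diagonal recurrence coefficient `α_n(t, α)`. -/
def recA (n : ℕ) (t α : ℝ) : ℝ :=
  inner (weight t α) (X * P n t α) (P n t α) / h n t α

/-- The recurrence coefficient `β_n(t, α)` (with `β_0 = 0`, since `β_0 P_{-1} = 0`). -/
def recB : ℕ → ℝ → ℝ → ℝ
  | 0, _, _ => 0
  | n + 1, t, α => inner (weight t α) (X * P (n + 1) t α) (P n t α) / h n t α

/-- `x_{j,n}(t, α)`, `1 ≤ j ≤ n`: the `j`-th smallest real zero of `P_n(x; t, α)`, counted with
multiplicity (and `0` if there is no such zero). -/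
def zero (n j : ℕ) (t α : ℝ) : ℝ := ((P n t α).roots.sort (· ≤ ·)).getD (j - 1) 0

/-- `c_n = 4 cos² (π / (n + 1)) + ε`. -/
def chainC (n : ℕ) (ε : ℝ) : ℝ := 4 * Real.cos (Real.pi / (n + 1)) ^ 2 + ε

/-- The expression, indexed by `k ≥ 1`, whose minimum over `k` is `a_n` (where `c = c_n`). -/
def lowerTerm (c t α : ℝ) (k : ℕ) : ℝ :=
  1 / 2 * (recA k t α + recA (k - 1) t α)
    - 1 / 2 * √((recA k t α - recA (k - 1) t α) ^ 2 + 4 * c * recB k t α)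

/-- The expression, indexed by `k ≥ 1`, whose maximum over `k` is `b_n` (where `c = c_n`). -/
def upperTerm (c t α : ℝ) (k : ℕ) : ℝ :=
  1 / 2 * (recA k t α + recA (k - 1) t α)
    + 1 / 2 * √((recA k t α - recA (k - 1) t α) ^ 2 + 4 * c * recB k t α)

theorem nonempty_Icc_of_two_le {n : ℕ} (hn : 2 ≤ n) : (Finset.Icc 1 (n - 1)).Nonempty :=
  Finset.nonempty_Icc.2 (by omega)

/-- `a_n`. -/
def outerLower {n : ℕ} (hn : 2 ≤ n) (ε t α : ℝ) : ℝ :=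
  (Finset.Icc 1 (n - 1)).inf' (nonempty_Icc_of_two_le hn) (lowerTerm (chainC n ε) t α)

/-- `b_n`. -/
def outerUpper {n : ℕ} (hn : 2 ≤ n) (ε t α : ℝ) : ℝ :=
  (Finset.Icc 1 (n - 1)).sup' (nonempty_Icc_of_two_le hn) (upperTerm (chainC n ε) t α)

/-- `d_n`, for `n ≥ 2`. -/
def d (n : ℕ) (t α : ℝ) : ℝ :=
  (P n t α).eval 0 / (P (n - 1) t α).eval 0
    + (P (n - 1) t (α + 1)).eval 0 / (P (n - 2) t (α + 1)).eval 0

/-- `e_n`, for `n ≥ 2`. -/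
def e (n : ℕ) (t α : ℝ) : ℝ :=
  ((P (n - 1) t α).eval 0 / (P (n - 2) t α).eval 0)
    * ((P (n - 1) t (α + 1)).eval 0 / (P (n - 2) t (α + 1)).eval 0)

end SPLaguerre

end

/-! Integration against the weight is a linear functional `L` with `L (p²) > 0` and `L (x p²) > 0`
for `p ≠ 0`. Most of the theorem follows from this positivity and from Gauss quadrature
(`IsOrthPoly.exists_quadrature`): on degrees below `2 n`, `L` is a sum over the zeros of `P_n` with
positive coefficients.

Zeros: split off a nonpositive, double or non-real zero and pair `P_n` with the cofactor;
orthogonality then contradicts positivity. Quadrature also shows that `P_{n-1}` alternates in sign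
along the zeros of `P_n`, which gives interlacing.

Monotonicity is Markov's theorem, proved without differentiating the zeros
(`IsWeight.nthRoot_lt_nthRoot`): two weights with increasing ratio are tested on one polynomial `(x
- ξ) F²`, whose sign is known at the nodes of both quadratures.

Inner bounds: a mean of the zeros with positive weights lies strictly between the extreme ones. The
weights come from applying quadrature to `(x - α_{n-1}) P_{n-1}²`, and to `P_{n-1} S` with `S` the
polynomial of degree `n - 2` for `α + 2`; multiplying the weight by `x` twice relates `S` to
`P_{n-1}` at the zeros of `P_n` (`between_of_double_kernel`).

Outer bounds: at a point `x` above all `y_k^+`, the numbers `u_k = x - α_k` are positive and `c_n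
β_k ≤ u_k u_{k-1}`. The recurrence is then compared with the one solved by `sin ((k + 1) θ)`, `θ = π
/ (n + 1)`, which first vanishes at `k = n`; so `P_n(x) > 0` unless every inequality is an equality
(`eq_of_upper_le`). The lower bound follows by reflection. -/

noncomputable section

namespace SPLaguerre

/-! ### Sorted real roots and positive functionals. -/

/-- The `j`-th smallest real root of a polynomial (`j ≥ 1`), counted with multiplicity. -/
def nthRoot (Q : ℝ[X]) (j : ℕ) : ℝ := (Q.roots.sort (· ≤ ·)).getD (j - 1) 0

/-- A linear functional on polynomials which is positive on `p ^ 2` and on `X * p ^ 2`. -/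
structure IsStieltjes (L : ℝ[X] →ₗ[ℝ] ℝ) : Prop where
  pos : ∀ p : ℝ[X], p ≠ 0 → 0 < L (p * p)
  pos_X : ∀ p : ℝ[X], p ≠ 0 → 0 < L (X * (p * p))

/-- `Q` is the monic orthogonal polynomial of degree `n` for the functional `L`. -/
structure IsOrthPoly (L : ℝ[X] →ₗ[ℝ] ℝ) (n : ℕ) (Q : ℝ[X]) : Prop where
  monic : Q.Monic
  natDegree_eq : Q.natDegree = n
  orth : ∀ q : ℝ[X], q.degree < n → L (Q * q) = 0

theorem nthRoot_strictMonoOn {Q : ℝ[X]} (hnd : Q.roots.Nodup) :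
    StrictMonoOn (nthRoot Q) (Set.Icc 1 Q.roots.card) := by
  intro i hi j hj hij
  have hs : (Q.roots.sort (· ≤ ·)).SortedLT := by
    rw [List.sortedLT_iff_nodup_and_sortedLE]
    refine ⟨?_, (Multiset.pairwise_sort Q.roots (· ≤ ·)).sortedLE⟩
    rw [← Multiset.coe_nodup, Multiset.sort_eq]; exact hnd
  have hlen : (Q.roots.sort (· ≤ ·)).length = Q.roots.card := Multiset.length_sort _
  obtain ⟨hi1, hi2⟩ := hi
  obtain ⟨hj1, hj2⟩ := hj
  unfold nthRoot
  rw [List.getD_eq_getElem _ _ (by omega), List.getD_eq_getElem _ _ (by omega)]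
  exact hs.getElem_lt_getElem_iff.2 (by omega)

theorem mem_roots_iff_nthRoot {Q : ℝ[X]} {x : ℝ} :
    x ∈ Q.roots ↔ ∃ j ∈ Finset.Icc 1 Q.roots.card, nthRoot Q j = x := by
  have hlen : (Q.roots.sort (· ≤ ·)).length = Q.roots.card := Multiset.length_sort _
  rw [← Multiset.mem_sort (· ≤ ·), List.mem_iff_getElem]
  constructor
  · rintro ⟨i, hi, rfl⟩
    refine ⟨i + 1, Finset.mem_Icc.2 ⟨by omega, by omega⟩, ?_⟩
    simp only [nthRoot, Nat.add_sub_cancel]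
    exact List.getD_eq_getElem _ _ hi
  · rintro ⟨j, hj, rfl⟩
    rw [Finset.mem_Icc] at hj
    exact ⟨j - 1, by omega, (List.getD_eq_getElem _ _ (by omega)).symm⟩

theorem nthRoot_injOn {Q : ℝ[X]} (hnd : Q.roots.Nodup) :
    Set.InjOn (nthRoot Q) (Finset.Icc 1 Q.roots.card : Finset ℕ) := by
  rw [Finset.coe_Icc]; exact (nthRoot_strictMonoOn hnd).injOn

theorem eq_nodal_nthRoot {Q : ℝ[X]} (hm : Q.Monic) (hnd : Q.roots.Nodup)
    (hcard : Q.roots.card = Q.natDegree) :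
    Q = Lagrange.nodal (Finset.Icc 1 Q.natDegree) (nthRoot Q) := by
  have hinj := nthRoot_injOn hnd
  have : Q.roots = ((Finset.Icc 1 Q.roots.card).image (nthRoot Q)).val := by
    refine (Multiset.Nodup.ext hnd (Finset.nodup _)).2 fun x => ?_
    rw [mem_roots_iff_nthRoot, Finset.mem_val, Finset.mem_image]
  conv_lhs => rw [← prod_multiset_X_sub_C_of_monic_of_roots_card_eq hm hcard, this]
  rw [Lagrange.nodal_eq, ← hcard]
  exact Finset.prod_image (f := fun a => X - C a) hinj

/-- A strictly increasing enumeration of roots of full length is the sorted one. -/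
theorem nthRoot_eq_of_strictMonoOn {Q : ℝ[X]} (h0 : Q ≠ 0) {n : ℕ} (hcard : Q.roots.card = n)
    {y : ℕ → ℝ} (hy : StrictMonoOn y (Set.Icc 1 n)) (hr : ∀ j ∈ Set.Icc 1 n, Q.eval (y j) = 0) :
    ∀ j ∈ Set.Icc 1 n, nthRoot Q j = y j := by
  have hinj : Set.InjOn y (Finset.Icc 1 n : Finset ℕ) := by rw [Finset.coe_Icc]; exact hy.injOn
  have hle : ((Finset.Icc 1 n).image y).val ≤ Q.roots := by
    rw [Multiset.le_iff_subset (Finset.nodup _)]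
    intro x hx
    rw [Finset.mem_val, Finset.mem_image] at hx
    obtain ⟨j, hj, rfl⟩ := hx
    exact (mem_roots h0).2 (hr j (by simpa using hj))
  have heq : ((Finset.Icc 1 n).image y).val = Q.roots := by
    refine Multiset.eq_of_le_of_card_le hle ?_
    rw [← Finset.card_def, Finset.card_image_of_injOn hinj, hcard]; simp
  have hl : Q.roots.sort (· ≤ ·) = (List.range n).map fun i => y (i + 1) := by
    refine List.Perm.eq_of_sortedLE (Multiset.pairwise_sort Q.roots (· ≤ ·)).sortedLE ?_ ?_
    · rw [List.sortedLE_iff_pairwise, List.pairwise_map]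
      refine List.Pairwise.imp_of_mem ?_ List.pairwise_lt_range
      intro a b ha hb hab
      rw [List.mem_range] at ha hb
      exact (hy ⟨by omega, by omega⟩ ⟨by omega, by omega⟩ (by omega)).le
    · rw [← Multiset.coe_eq_coe, Multiset.sort_eq, ← heq, ← Multiset.map_coe]
      rw [Finset.image_val_of_injOn hinj]
      have : (Finset.Icc 1 n).val = Multiset.map (· + 1) (List.range n : Multiset ℕ) := by
        have : Finset.Icc 1 n = (Finset.range n).image (· + 1) := by
          ext a; simp only [Finset.mem_Icc, Finset.mem_image, Finset.mem_range]
          exact ⟨fun h => ⟨a - 1, by omega, by omega⟩, by rintro ⟨b, hb, rfl⟩; omega⟩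
        rw [this, Finset.image_val_of_injOn (fun a _ b _ h => by simpa using h)]
        rfl
      rw [this, Multiset.map_map]; rfl
  intro j hj
  obtain ⟨hj1, hj2⟩ := hj
  unfold nthRoot
  rw [hl, List.getD_eq_getElem _ _ (by simp; omega)]
  simp only [List.getElem_map, List.getElem_range]
  congr 1; omega

/-! ### Location of the zeros and Gauss quadrature. -/

namespace IsOrthPoly

variable {L : ℝ[X] →ₗ[ℝ] ℝ} {n : ℕ} {Q : ℝ[X]}

theorem orth_of_natDegree_lt (h : IsOrthPoly L n Q) {q : ℝ[X]} (hq : q.natDegree < n) :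
    L (Q * q) = 0 :=
  h.orth q (lt_of_le_of_lt degree_le_natDegree (by exact_mod_cast hq))

theorem unique (hL : IsStieltjes L) (h : IsOrthPoly L n Q) {R : ℝ[X]} (h' : IsOrthPoly L n R) :
    Q = R := by
  by_contra hne
  have hd : (Q - R).degree < n := by
    have := degree_sub_lt_left (p := Q) (q := R) (by
      rw [degree_eq_natDegree h.monic.ne_zero, degree_eq_natDegree h'.monic.ne_zero,
        h.natDegree_eq, h'.natDegree_eq]) h.monic.ne_zero (by rw [h.monic, h'.monic])
    rwa [degree_eq_natDegree h.monic.ne_zero, h.natDegree_eq] at this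
  have := hL.pos (Q - R) (sub_ne_zero.2 hne)
  rw [sub_mul, map_sub, h.orth _ hd, h'.orth _ hd] at this
  simp at this

theorem apply_self_mul (h : IsOrthPoly L n Q) {q : ℝ[X]} (hm : q.Monic) (hd : q.natDegree = n) :
    L (Q * q) = L (Q * Q) := by
  have hlt : (q - Q).degree < n := by
    have := degree_sub_lt_left (p := q) (q := Q) (by
      rw [degree_eq_natDegree h.monic.ne_zero, degree_eq_natDegree hm.ne_zero,
        h.natDegree_eq, hd]) hm.ne_zero (by rw [h.monic, hm])
    rwa [degree_eq_natDegree hm.ne_zero, hd] at this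
  have := h.orth _ hlt
  rw [mul_sub, map_sub] at this
  linarith

/-- With `Q = (X - x) g`, orthogonality to `g` reads `L (X g²) = x L (g²)`, and both values of `L`
are positive. -/
theorem pos_of_root (hL : IsStieltjes L) (h : IsOrthPoly L n Q) {x : ℝ} (hx : Q.eval x = 0) :
    0 < x := by
  obtain ⟨g, hg⟩ := dvd_iff_isRoot.2 hx
  have hg0 : g ≠ 0 := by rintro rfl; exact h.monic.ne_zero (by simpa using hg)
  have hdeg : g.natDegree < n := by
    rw [← h.natDegree_eq, hg, natDegree_mul (X_sub_C_ne_zero x) hg0, natDegree_X_sub_C]; omega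
  have h1 := h.orth_of_natDegree_lt hdeg
  have e : Q * g = X * (g * g) - x • (g * g) := by
    rw [smul_eq_C_mul]; nth_rewrite 1 [hg]; ring
  rw [e, map_sub, map_smul, smul_eq_mul] at h1
  have h2 := hL.pos g hg0
  have h3 := hL.pos_X g hg0
  by_contra hneg
  nlinarith

/-- If `Q = (X - x)² g`, then `Q g` is the square of `(X - x) g`, yet `L (Q g) = 0`. -/
theorem nodup_roots (hL : IsStieltjes L) (h : IsOrthPoly L n Q) : Q.roots.Nodup := by
  rw [Multiset.nodup_iff_count_le_one]
  intro x
  by_contra hc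
  rw [count_roots] at hc
  have hdvd : (X - C x) ^ 2 ∣ Q :=
    (le_rootMultiplicity_iff h.monic.ne_zero).1 (by omega)
  obtain ⟨g, hg⟩ := hdvd
  have hg0 : g ≠ 0 := by rintro rfl; exact h.monic.ne_zero (by simpa using hg)
  have hdeg : g.natDegree < n := by
    rw [← h.natDegree_eq, hg, natDegree_mul (pow_ne_zero 2 (X_sub_C_ne_zero x)) hg0,
      natDegree_pow, natDegree_X_sub_C]; omega
  have h1 := h.orth_of_natDegree_lt hdeg
  have h2 := hL.pos ((X - C x) * g) (mul_ne_zero (X_sub_C_ne_zero x) hg0)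
  have e : Q * g = (X - C x) * g * ((X - C x) * g) := by nth_rewrite 1 [hg]; ring
  rw [e] at h1
  exact h2.ne' h1

/-- A non-real zero contributes the real factor `(X - re z)² + (im z)²`, which makes `Q g` a sum of
two nonzero squares. -/
theorem im_eq_zero_of_root (hL : IsStieltjes L) (h : IsOrthPoly L n Q) {z : ℂ}
    (hz : aeval z Q = 0) : z.im = 0 := by
  by_contra him
  obtain ⟨g, hg⟩ := Polynomial.quadratic_dvd_of_aeval_eq_zero_im_ne_zero Q hz him
  set r : ℝ[X] := X ^ 2 - C (2 * z.re) * X + C (‖z‖ ^ 2) with hr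
  have hrm : r.natDegree = 2 := by rw [hr]; compute_degree!
  have hr0 : r ≠ 0 := by intro h0; rw [h0] at hrm; simp at hrm
  have hg0 : g ≠ 0 := by rintro rfl; exact h.monic.ne_zero (by simpa using hg)
  have hdeg : g.natDegree < n := by
    rw [← h.natDegree_eq, hg, natDegree_mul hr0 hg0, hrm]; omega
  have h1 := h.orth_of_natDegree_lt hdeg
  have h2 := hL.pos ((X - C z.re) * g) (mul_ne_zero (X_sub_C_ne_zero _) hg0)
  have h3 := hL.pos (z.im • g) (smul_ne_zero him hg0)
  have e : Q * g = (X - C z.re) * g * ((X - C z.re) * g) + (z.im • g) * (z.im • g) := by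
    have : ‖z‖ ^ 2 = z.re * z.re + z.im * z.im := by
      rw [← Complex.normSq_eq_norm_sq, Complex.normSq_apply]
    rw [smul_eq_C_mul]; nth_rewrite 1 [hg]; rw [hr, this]
    simp only [C_add, C_mul, map_ofNat]; ring
  rw [e, map_add] at h1
  linarith

theorem splits (hL : IsStieltjes L) (h : IsOrthPoly L n Q) : Q.Splits := by
  refine Splits.of_splits_map (algebraMap ℝ ℂ) (IsAlgClosed.splits _) fun z hz => ?_
  have hz' : aeval z Q = 0 := by
    rw [mem_roots', IsRoot.def, eval_map_algebraMap] at hz; exact hz.2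
  exact ⟨z.re, Complex.ext (by simp) (by simp [h.im_eq_zero_of_root hL hz'])⟩

theorem card_roots (hL : IsStieltjes L) (h : IsOrthPoly L n Q) : Q.roots.card = n := by
  rw [← h.natDegree_eq]; exact (h.splits hL).natDegree_eq_card_roots.symm

theorem strictMonoOn (hL : IsStieltjes L) (h : IsOrthPoly L n Q) :
    StrictMonoOn (nthRoot Q) (Set.Icc 1 n) := by
  rw [← h.card_roots hL]; exact nthRoot_strictMonoOn (h.nodup_roots hL)

theorem injOn (hL : IsStieltjes L) (h : IsOrthPoly L n Q) :
    Set.InjOn (nthRoot Q) (Finset.Icc 1 n : Finset ℕ) := by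
  rw [Finset.coe_Icc]; exact (h.strictMonoOn hL).injOn

theorem eval_eq_zero_iff (hL : IsStieltjes L) (h : IsOrthPoly L n Q) {x : ℝ} :
    Q.eval x = 0 ↔ ∃ j ∈ Finset.Icc 1 n, nthRoot Q j = x := by
  rw [← h.card_roots hL, ← mem_roots_iff_nthRoot, mem_roots h.monic.ne_zero, IsRoot.def]

theorem eval_nthRoot (hL : IsStieltjes L) (h : IsOrthPoly L n Q) {j : ℕ}
    (hj : j ∈ Finset.Icc 1 n) : Q.eval (nthRoot Q j) = 0 :=
  (h.eval_eq_zero_iff hL).2 ⟨j, hj, rfl⟩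

theorem eq_nodal (hL : IsStieltjes L) (h : IsOrthPoly L n Q) :
    Q = Lagrange.nodal (Finset.Icc 1 n) (nthRoot Q) := by
  have := eq_nodal_nthRoot h.monic (h.nodup_roots hL) (by rw [h.card_roots hL, h.natDegree_eq])
  rwa [h.natDegree_eq] at this

/-- Gauss quadrature. -/
theorem exists_quadrature (hL : IsStieltjes L) (h : IsOrthPoly L n Q) :
    ∃ c : ℕ → ℝ, (∀ j ∈ Finset.Icc 1 n, 0 < c j) ∧ ∀ g : ℝ[X], g.natDegree < 2 * n →
      L g = ∑ j ∈ Finset.Icc 1 n, c j * g.eval (nthRoot Q j) := by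
  have hinj := h.injOn hL
  have key : ∀ g : ℝ[X], g.natDegree < 2 * n → L g = ∑ j ∈ Finset.Icc 1 n,
      L (Lagrange.basis (Finset.Icc 1 n) (nthRoot Q) j) * g.eval (nthRoot Q j) := by
    intro g hg
    -- The quotient by `Q` has degree below `n`, so orthogonality removes it; the remainder equals
    -- its Lagrange interpolant and agrees with `g` at the nodes.
    have hmod : L g = L (g %ₘ Q) := by
      conv_lhs => rw [← modByMonic_add_div g Q]
      rw [map_add, h.orth_of_natDegree_lt, add_zero]
      rw [natDegree_divByMonic _ h.monic, h.natDegree_eq]; omega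
    have hint := Lagrange.eq_interpolate hinj (f := g %ₘ Q) (by
      have := degree_modByMonic_lt g h.monic
      rw [degree_eq_natDegree h.monic.ne_zero, h.natDegree_eq] at this
      simpa using this)
    rw [hmod, hint, Lagrange.interpolate_apply, map_sum]
    refine Finset.sum_congr rfl fun j hj => ?_
    have he : (g %ₘ Q).eval (nthRoot Q j) = g.eval (nthRoot Q j) := by
      conv_rhs => rw [← modByMonic_add_div g Q]
      rw [eval_add, eval_mul, h.eval_nthRoot hL hj]; ring
    rw [he, ← smul_eq_C_mul, map_smul, smul_eq_mul, mul_comm]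
  refine ⟨_, fun j hj => ?_, key⟩
  -- Testing on `ℓ²`, of degree `2 n - 2`, identifies the `j`-th coefficient as `L (ℓ²)`.
  set ℓ := Lagrange.basis (Finset.Icc 1 n) (nthRoot Q) j with hℓ
  have hℓ0 : ℓ ≠ 0 := Lagrange.basis_ne_zero hinj hj
  have hn : 1 ≤ n := by rw [Finset.mem_Icc] at hj; omega
  have hdeg : (ℓ * ℓ).natDegree < 2 * n := by
    rw [natDegree_mul hℓ0 hℓ0, hℓ, Lagrange.natDegree_basis hinj hj]; simp; omega
  have h1 := key _ hdeg
  rw [Finset.sum_eq_single j] at h1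
  · rw [eval_mul, hℓ, Lagrange.eval_basis_self hinj hj] at h1
    have := hL.pos ℓ hℓ0
    rw [hℓ, h1] at this
    simpa using this
  · intro i hi hij
    rw [eval_mul, hℓ, Lagrange.eval_basis_of_ne (Ne.symm hij) hi]; ring
  · intro hj'; exact absurd hj hj'

end IsOrthPoly

/-! ### Interlacing and weighted means of the zeros. -/

namespace IsOrthPoly

variable {L : ℝ[X] →ₗ[ℝ] ℝ} {n : ℕ} {Q R : ℝ[X]}

theorem pos_self (hL : IsStieltjes L) (h : IsOrthPoly L n Q) : 0 < L (Q * Q) :=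
  hL.pos Q h.monic.ne_zero

theorem ne_zero_at_zero (hL : IsStieltjes L) (h : IsOrthPoly L n Q) : Q.eval 0 ≠ 0 :=
  fun h0 => (h.pos_of_root hL h0).ne' rfl

/-- The values of the previous orthogonal polynomial at the roots have the sign of the derivative. -/
theorem prev_mul_prod_pos (hL : IsStieltjes L) (h : IsOrthPoly L (n + 1) Q)
    (h' : IsOrthPoly L n R) {j : ℕ} (hj : j ∈ Finset.Icc 1 (n + 1)) :
    0 < R.eval (nthRoot Q j) *
      ∏ i ∈ (Finset.Icc 1 (n + 1)).erase j, (nthRoot Q j - nthRoot Q i) := by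
  obtain ⟨c, hc, hquad⟩ := h.exists_quadrature hL
  set g := Lagrange.nodal ((Finset.Icc 1 (n + 1)).erase j) (nthRoot Q) with hg
  have hgd : g.natDegree = n := by
    rw [hg, Lagrange.natDegree_nodal, Finset.card_erase_of_mem hj]; simp
  -- As `g` is monic of degree `n` and vanishes at every node but the `j`-th, quadrature leaves one
  -- term, equal to `L (R²) > 0`.
  have h1 : L (R * g) = L (R * R) := h'.apply_self_mul Lagrange.nodal_monic hgd
  rw [hquad _ (by
    rw [natDegree_mul h'.monic.ne_zero Lagrange.nodal_ne_zero, hgd, h'.natDegree_eq]; omega),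
    Finset.sum_eq_single j] at h1
  · have h2 := h'.pos_self hL
    rw [← h1, eval_mul, hg, Lagrange.eval_nodal] at h2
    exact pos_of_mul_pos_right h2 (hc j hj).le
  · intro i hi hij
    rw [eval_mul, hg, Lagrange.eval_nodal_at_node (Finset.mem_erase.2 ⟨hij, hi⟩)]; ring
  · intro hj'; exact absurd hj hj'

theorem prev_ne_zero (hL : IsStieltjes L) (h : IsOrthPoly L (n + 1) Q)
    (h' : IsOrthPoly L n R) {j : ℕ} (hj : j ∈ Finset.Icc 1 (n + 1)) :
    R.eval (nthRoot Q j) ≠ 0 := by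
  intro h0
  have := h.prev_mul_prod_pos hL h' hj
  rw [h0, zero_mul] at this
  exact this.false

/-- Between consecutive nodes only the factor joining these two nodes changes sign in the product of
`prev_mul_prod_pos`. -/
theorem prev_mul_prev_neg (hL : IsStieltjes L) (h : IsOrthPoly L (n + 1) Q)
    (h' : IsOrthPoly L n R) {j : ℕ} (hj : 1 ≤ j) (hjn : j ≤ n) :
    R.eval (nthRoot Q j) * R.eval (nthRoot Q (j + 1)) < 0 := by
  have hmono := h.strictMonoOn hL
  have m1 : j ∈ Finset.Icc 1 (n + 1) := Finset.mem_Icc.2 ⟨hj, by omega⟩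
  have m2 : j + 1 ∈ Finset.Icc 1 (n + 1) := Finset.mem_Icc.2 ⟨by omega, by omega⟩
  have p1 := h.prev_mul_prod_pos hL h' m1
  have p2 := h.prev_mul_prod_pos hL h' m2
  set T := ((Finset.Icc 1 (n + 1)).erase j).erase (j + 1) with hT
  have e1 : (Finset.Icc 1 (n + 1)).erase j = insert (j + 1) T :=
    (Finset.insert_erase (Finset.mem_erase.2 ⟨by omega, m2⟩)).symm
  have e2 : (Finset.Icc 1 (n + 1)).erase (j + 1) = insert j T := by
    rw [hT, Finset.erase_right_comm]
    exact (Finset.insert_erase (Finset.mem_erase.2 ⟨by omega, m1⟩)).symm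
  rw [e1, Finset.prod_insert (by simp [hT])] at p1
  rw [e2, Finset.prod_insert (by simp [hT])] at p2
  have hlt : nthRoot Q j < nthRoot Q (j + 1) :=
    hmono ⟨hj, by omega⟩ ⟨by omega, by omega⟩ (by omega)
  have hprod : 0 < (∏ i ∈ T, (nthRoot Q j - nthRoot Q i)) *
      ∏ i ∈ T, (nthRoot Q (j + 1) - nthRoot Q i) := by
    rw [← Finset.prod_mul_distrib]
    refine Finset.prod_pos fun i hi => ?_
    rw [hT, Finset.mem_erase, Finset.mem_erase, Finset.mem_Icc] at hi
    obtain ⟨hi1, hi2, hi3, hi4⟩ := hi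
    rcases lt_or_gt_of_ne hi2 with hlt' | hgt
    · have a1 : nthRoot Q i < nthRoot Q j := hmono ⟨hi3, hi4⟩ ⟨hj, by omega⟩ hlt'
      exact mul_pos (by linarith) (by linarith)
    · have a1 : nthRoot Q (j + 1) < nthRoot Q i :=
        hmono ⟨by omega, by omega⟩ ⟨hi3, hi4⟩ (by omega)
      exact mul_pos_of_neg_of_neg (by linarith) (by linarith)
  have hpp := mul_pos p1 p2
  set A := R.eval (nthRoot Q j)
  set B := R.eval (nthRoot Q (j + 1))
  set D := (∏ i ∈ T, (nthRoot Q j - nthRoot Q i)) *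
      ∏ i ∈ T, (nthRoot Q (j + 1) - nthRoot Q i) with hD
  have hE : 0 < D * (nthRoot Q (j + 1) - nthRoot Q j) ^ 2 :=
    mul_pos hprod (pow_pos (sub_pos.2 hlt) 2)
  have : 0 < -(A * B) * (D * (nthRoot Q (j + 1) - nthRoot Q j) ^ 2) := by
    refine hpp.trans_eq ?_
    rw [hD]; ring
  have := pos_of_mul_pos_left this hE.le
  linarith

/-- Each of the `n` gaps between nodes contains a zero of `R` by the intermediate value theorem;
these increase and exhaust the `n` zeros, so they are the sorted ones. -/
theorem interlace (hL : IsStieltjes L) (h : IsOrthPoly L (n + 1) Q)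
    (h' : IsOrthPoly L n R) {j : ℕ} (hj : 1 ≤ j) (hjn : j ≤ n) :
    nthRoot Q j < nthRoot R j ∧ nthRoot R j < nthRoot Q (j + 1) := by
  have hmono := h.strictMonoOn hL
  have hex : ∀ i : ℕ, ∃ y : ℝ, i ∈ Set.Icc 1 n →
      nthRoot Q i < y ∧ y < nthRoot Q (i + 1) ∧ R.eval y = 0 := by
    intro i
    by_cases hi : i ∈ Set.Icc 1 n
    · have hneg := h.prev_mul_prev_neg hL h' hi.1 hi.2
      have hlt : nthRoot Q i < nthRoot Q (i + 1) :=
        hmono ⟨hi.1, hi.2.trans (by omega)⟩ ⟨by omega, by have := hi.2; omega⟩ (by omega)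
      rcases mul_neg_iff.1 hneg with ⟨h1, h2⟩ | ⟨h1, h2⟩
      · obtain ⟨y, hy, hy0⟩ := intermediate_value_Ioo' hlt.le R.continuous.continuousOn ⟨h2, h1⟩
        exact ⟨y, fun _ => ⟨hy.1, hy.2, hy0⟩⟩
      · obtain ⟨y, hy, hy0⟩ := intermediate_value_Ioo hlt.le R.continuous.continuousOn ⟨h1, h2⟩
        exact ⟨y, fun _ => ⟨hy.1, hy.2, hy0⟩⟩
    · exact ⟨0, fun hi' => absurd hi' hi⟩
  choose y hy using hex
  have hymono : StrictMonoOn y (Set.Icc 1 n) := by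
    intro a ha b hb hab
    have h1 := (hy a ha).2.1
    have h2 := (hy b hb).1
    have h3 : nthRoot Q (a + 1) ≤ nthRoot Q b :=
      hmono.monotoneOn ⟨by omega, by have := hb.2; omega⟩ ⟨hb.1, hb.2.trans (by omega)⟩ hab
    linarith
  have := nthRoot_eq_of_strictMonoOn h'.monic.ne_zero (h'.card_roots hL) hymono
    (fun i hi => (hy i hi).2.2) j ⟨hj, hjn⟩
  rw [this]
  exact ⟨(hy j ⟨hj, hjn⟩).1, (hy j ⟨hj, hjn⟩).2.1⟩

/-- A weighted mean of the roots, with at least two roots, is strictly between the extreme ones. -/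
theorem between_of_sum_eq_zero (hL : IsStieltjes L) (h : IsOrthPoly L n Q) (hn : 2 ≤ n)
    {c : ℕ → ℝ} (hc : ∀ j ∈ Finset.Icc 1 n, 0 < c j) {a : ℝ}
    (hsum : ∑ j ∈ Finset.Icc 1 n, c j * (nthRoot Q j - a) = 0) :
    nthRoot Q 1 < a ∧ a < nthRoot Q n := by
  have hmono := h.strictMonoOn hL
  have hlt : nthRoot Q 1 < nthRoot Q n := hmono ⟨le_rfl, by omega⟩ ⟨by omega, le_rfl⟩ (by omega)
  constructor
  · by_contra hcon
    refine (Finset.sum_pos' (fun j hj => ?_) ⟨n, Finset.mem_Icc.2 ⟨by omega, le_rfl⟩, ?_⟩).ne' hsum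
    · have hj' := Finset.mem_Icc.1 hj
      have : nthRoot Q 1 ≤ nthRoot Q j := hmono.monotoneOn ⟨le_rfl, by omega⟩ hj' hj'.1
      exact mul_nonneg (hc j hj).le (by linarith)
    · exact mul_pos (hc n (Finset.mem_Icc.2 ⟨by omega, le_rfl⟩)) (by linarith)
  · by_contra hcon
    refine (Finset.sum_neg' (fun j hj => ?_) ⟨1, Finset.mem_Icc.2 ⟨le_rfl, by omega⟩, ?_⟩).ne hsum
    · have hj' := Finset.mem_Icc.1 hj
      have : nthRoot Q j ≤ nthRoot Q n := hmono.monotoneOn hj' ⟨by omega, le_rfl⟩ hj'.2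
      exact mul_nonpos_of_nonneg_of_nonpos (hc j hj).le (by linarith)
    · exact mul_neg_of_pos_of_neg (hc 1 (Finset.mem_Icc.2 ⟨le_rfl, by omega⟩)) (by linarith)

/-- The quotient `a` is characterized by `L ((X - a) R²) = 0`. This has degree `2 n + 1`, just
within reach of quadrature with `n + 1` nodes. -/
theorem between_recurrence_coeff (hL : IsStieltjes L) (h : IsOrthPoly L (n + 1) Q)
    (h' : IsOrthPoly L n R) (hn : 1 ≤ n) :
    nthRoot Q 1 < L (X * R * R) / L (R * R) ∧ L (X * R * R) / L (R * R) < nthRoot Q (n + 1) := by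
  obtain ⟨c, hc, hquad⟩ := h.exists_quadrature hL
  have hpos := h'.pos_self hL
  refine h.between_of_sum_eq_zero hL (by omega) (c := fun j => c j * R.eval (nthRoot Q j) ^ 2)
    (fun j hj => mul_pos (hc j hj) ((by have := h.prev_ne_zero hL h' hj; positivity))) ?_
  set a := L (X * R * R) / L (R * R) with ha
  have hR := h'.monic.ne_zero
  have h1 : L (X * R * R - a • (R * R)) = 0 := by
    rw [map_sub, map_smul, smul_eq_mul, ha]; field_simp; ring
  rw [hquad _ (by
    refine lt_of_le_of_lt (natDegree_sub_le _ _) (max_lt ?_ ?_)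
    · rw [natDegree_mul (mul_ne_zero X_ne_zero hR) hR, natDegree_mul X_ne_zero hR, natDegree_X,
        h'.natDegree_eq]; omega
    · refine lt_of_le_of_lt (natDegree_smul_le _ _) ?_
      rw [natDegree_mul hR hR, h'.natDegree_eq]; omega)] at h1
  rw [← h1]
  refine Finset.sum_congr rfl fun j _ => ?_
  simp only [eval_sub, eval_mul, eval_X, eval_smul, smul_eq_mul]; ring

end IsOrthPoly

/-! ### Gram-Schmidt and the three-term recurrence. -/

/-- Monic polynomials of degrees `0, …, m - 1` span everything of degree below `m`: strip off the
leading term repeatedly. -/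
theorem apply_mul_eq_zero_of_forall_lt {L : ℝ[X] →ₗ[ℝ] ℝ} {p : ℕ → ℝ[X]} {D : ℝ[X]} {m : ℕ}
    (hm : ∀ k < m, (p k).Monic ∧ (p k).natDegree = k) (hD : ∀ k < m, L (D * p k) = 0)
    {q : ℝ[X]} (hq : q.degree < m) : L (D * q) = 0 := by
  induction m generalizing q with
  | zero =>
    have : q = 0 := by
      rw [← degree_eq_bot]; exact Nat.WithBot.lt_zero_iff.1 (by simpa using hq)
    simp [this]
  | succ m ih =>
    obtain ⟨h1, h2⟩ := hm m (by omega)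
    have hlt : (q - q.coeff m • p m).degree < m := by
      rw [degree_lt_iff_coeff_zero]
      intro k hk
      rw [coeff_sub, coeff_smul, smul_eq_mul]
      rcases hk.eq_or_lt with rfl | hk
      · have : (p m).coeff m = 1 := by
          have := h1.coeff_natDegree; rwa [h2] at this
        rw [this]; ring
      · rw [coeff_eq_zero_of_natDegree_lt (p := p m) (by omega),
          coeff_eq_zero_of_degree_lt (p := q) (hq.trans_le (by exact_mod_cast hk))]; ring
    have := ih (fun k hk => hm k (by omega)) (fun k hk => hD k (by omega)) hlt
    rw [mul_sub, map_sub, mul_smul_comm, map_smul, hD m (by omega)] at this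
    simpa using this

/-- The Gram-Schmidt process yields the monic orthogonal polynomials. -/
theorem isOrthPoly_of_gramSchmidt {L : ℝ[X] →ₗ[ℝ] ℝ} (hL : IsStieltjes L) {p : ℕ → ℝ[X]}
    (hp : ∀ n, p n = X ^ n - ∑ k : Fin n, C (L (X ^ n * p k) / L (p k * p k)) * p k) (n : ℕ) :
    IsOrthPoly L n (p n) := by
  induction n using Nat.strong_induction_on with
  | _ n ih =>
    set S := ∑ k : Fin n, C (L (X ^ n * p k) / L (p k * p k)) * p k with hS
    have hSd : S.degree < n := by
      rw [← mem_degreeLT]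
      refine Submodule.sum_mem _ fun k _ => ?_
      rw [← smul_eq_C_mul]
      refine Submodule.smul_mem _ _ ?_
      rw [mem_degreeLT, degree_eq_natDegree (ih k k.2).monic.ne_zero, (ih k k.2).natDegree_eq]
      exact_mod_cast k.2
    have hSn : S.degree < (X ^ n : ℝ[X]).degree := by rwa [degree_X_pow]
    have hpn : p n = X ^ n - S := hp n
    have hdeg : (p n).degree = n := by
      rw [hpn, degree_sub_eq_left_of_degree_lt hSn, degree_X_pow]
    refine ⟨?_, natDegree_eq_of_degree_eq_some hdeg, fun q hq => ?_⟩
    · rw [hpn]; exact (monic_X_pow n).sub_of_left hSn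
    · refine apply_mul_eq_zero_of_forall_lt
        (fun k hk => ⟨(ih k hk).monic, (ih k hk).natDegree_eq⟩) (fun k hk => ?_) hq
      rw [hpn, sub_mul, map_sub, hS, Finset.sum_mul, map_sum, Finset.sum_eq_single ⟨k, hk⟩]
      · rw [mul_assoc, ← smul_eq_C_mul, map_smul, smul_eq_mul,
          div_mul_cancel₀ _ ((ih k hk).pos_self hL).ne', sub_self]
      · intro i _ hik
        rw [mul_assoc, ← smul_eq_C_mul, map_smul, smul_eq_mul]
        have hne : (i : ℕ) ≠ k := fun h => hik (Fin.ext h)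
        rcases lt_or_gt_of_ne hne with h | h
        · rw [mul_comm (p i) (p k),
            (ih k hk).orth_of_natDegree_lt (q := p i) (by rwa [(ih i i.2).natDegree_eq]), mul_zero]
        · rw [(ih i i.2).orth_of_natDegree_lt (q := p k) (by rwa [(ih k hk).natDegree_eq]),
            mul_zero]
      · intro h; exact absurd (Finset.mem_univ _) h

section Sequence

variable {L : ℝ[X] →ₗ[ℝ] ℝ} {p : ℕ → ℝ[X]}

theorem apply_mul_eq_zero_of_ne (hp : ∀ n, IsOrthPoly L n (p n)) {j k : ℕ} (hjk : j ≠ k) :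
    L (p j * p k) = 0 := by
  rcases lt_or_gt_of_ne hjk with h | h
  · rw [mul_comm]
    exact (hp k).orth_of_natDegree_lt (by rwa [(hp j).natDegree_eq])
  · exact (hp j).orth_of_natDegree_lt (by rwa [(hp k).natDegree_eq])

theorem eq_zero_of_forall_le (hL : IsStieltjes L) (hp : ∀ n, IsOrthPoly L n (p n)) {m : ℕ}
    {D : ℝ[X]} (hd : D.degree < (m + 1 : ℕ)) (hD : ∀ k ≤ m, L (D * p k) = 0) : D = 0 := by
  by_contra hne
  exact (hL.pos D hne).ne' (apply_mul_eq_zero_of_forall_lt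
    (fun k _ => ⟨(hp k).monic, (hp k).natDegree_eq⟩) (fun k hk => hD k (by omega)) hd)

theorem degree_X_mul_sub_succ_lt (hp : ∀ n, IsOrthPoly L n (p n)) (n : ℕ) :
    (X * p n - p (n + 1)).degree < ((n + 1 : ℕ) : WithBot ℕ) := by
  have hd : (X * p n).degree = ((n + 1 : ℕ) : WithBot ℕ) := by
    rw [degree_mul, degree_X, degree_eq_natDegree (hp n).monic.ne_zero, (hp n).natDegree_eq,
      add_comm]; rfl
  have := degree_sub_lt_left (p := X * p n) (q := p (n + 1)) (by
    rw [hd, degree_eq_natDegree (hp (n + 1)).monic.ne_zero, (hp (n + 1)).natDegree_eq])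
    (monic_X.mul (hp n).monic).ne_zero (by rw [monic_X.mul (hp n).monic, (hp (n + 1)).monic])
  rwa [hd] at this

theorem recurrence_zero (hL : IsStieltjes L) (hp : ∀ n, IsOrthPoly L n (p n)) :
    X * p 0 = p 1 + C (L (X * p 0 * p 0) / L (p 0 * p 0)) * p 0 := by
  set a := L (X * p 0 * p 0) / L (p 0 * p 0) with ha
  have h0 := (hp 0).pos_self hL
  have : X * p 0 - p 1 - a • p 0 = 0 := by
    refine eq_zero_of_forall_le hL hp (m := 0) ?_ fun k hk => ?_
    · rw [← mem_degreeLT]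
      refine Submodule.sub_mem _ (mem_degreeLT.2 (degree_X_mul_sub_succ_lt hp 0))
        (Submodule.smul_mem _ _ (mem_degreeLT.2 ?_))
      rw [degree_eq_natDegree (hp 0).monic.ne_zero, (hp 0).natDegree_eq]; norm_num
    · obtain rfl : k = 0 := by omega
      rw [sub_mul, sub_mul, map_sub, map_sub, apply_mul_eq_zero_of_ne hp (by omega),
        smul_mul_assoc, map_smul, smul_eq_mul, ha]
      field_simp; ring
  rw [smul_eq_C_mul] at this
  linear_combination this

theorem recurrence_succ (hL : IsStieltjes L) (hp : ∀ n, IsOrthPoly L n (p n)) (n : ℕ) :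
    X * p (n + 1) = p (n + 2)
      + C (L (X * p (n + 1) * p (n + 1)) / L (p (n + 1) * p (n + 1))) * p (n + 1)
      + C (L (X * p (n + 1) * p n) / L (p n * p n)) * p n := by
  set a := L (X * p (n + 1) * p (n + 1)) / L (p (n + 1) * p (n + 1)) with ha
  set b := L (X * p (n + 1) * p n) / L (p n * p n) with hb
  have h0 := (hp n).pos_self hL
  have h1 := (hp (n + 1)).pos_self hL
  have : X * p (n + 1) - p (n + 2) - a • p (n + 1) - b • p n = 0 := by
    refine eq_zero_of_forall_le hL hp (m := n + 1) ?_ fun k hk => ?_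
    · rw [← mem_degreeLT]
      refine Submodule.sub_mem _ (Submodule.sub_mem _
        (mem_degreeLT.2 (degree_X_mul_sub_succ_lt hp (n + 1)))
        (Submodule.smul_mem _ _ (mem_degreeLT.2 ?_))) (Submodule.smul_mem _ _ (mem_degreeLT.2 ?_))
      · rw [degree_eq_natDegree (hp (n + 1)).monic.ne_zero, (hp (n + 1)).natDegree_eq]
        exact_mod_cast Nat.lt_succ_self _
      · rw [degree_eq_natDegree (hp n).monic.ne_zero, (hp n).natDegree_eq]
        exact_mod_cast (by omega : n < n + 1 + 1)
    · rw [sub_mul, sub_mul, sub_mul, map_sub, map_sub, map_sub,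
        apply_mul_eq_zero_of_ne hp (by omega : n + 2 ≠ k), smul_mul_assoc, map_smul, smul_eq_mul,
        smul_mul_assoc, map_smul, smul_eq_mul]
      rcases hk.eq_or_lt with rfl | hk
      · rw [apply_mul_eq_zero_of_ne hp (by omega : n ≠ n + 1), ha]
        field_simp; ring
      · rcases (Nat.lt_succ_iff.1 hk).eq_or_lt with rfl | hk'
        · rw [apply_mul_eq_zero_of_ne hp (by omega : k + 1 ≠ k), hb]
          field_simp; ring
        -- For `k < n` the factor `X` moves onto `p k`, whose degree stays below `n + 1`.
        · rw [apply_mul_eq_zero_of_ne hp (by omega : n ≠ k),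
            apply_mul_eq_zero_of_ne hp (by omega : n + 1 ≠ k),
            show X * p (n + 1) * p k = p (n + 1) * (X * p k) by ring,
            (hp (n + 1)).orth_of_natDegree_lt]
          · ring
          · rw [natDegree_X_mul (hp k).monic.ne_zero, (hp k).natDegree_eq]; omega
  rw [smul_eq_C_mul, smul_eq_C_mul] at this
  linear_combination this

/-- Since `X p_n` is monic of degree `n + 1`, the value is `L (p_{n+1}²)`; this is the source of
`β_n > 0`. -/
theorem apply_X_mul_succ_mul_pos (hL : IsStieltjes L) (hp : ∀ n, IsOrthPoly L n (p n)) (n : ℕ) :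
    0 < L (X * p (n + 1) * p n) := by
  rw [show X * p (n + 1) * p n = p (n + 1) * (X * p n) by ring,
    (hp (n + 1)).apply_self_mul (monic_X.mul (hp n).monic)
      (by rw [natDegree_X_mul (hp n).monic.ne_zero, (hp n).natDegree_eq])]
  exact (hp (n + 1)).pos_self hL

end Sequence

/-! ### Multiplying the weight by `x`. -/

/-- The kernel polynomials: the effect of multiplying the weight by `x`. -/
theorem IsOrthPoly.X_mul_kernel {L L' : ℝ[X] →ₗ[ℝ] ℝ} (hL : IsStieltjes L)
    (hL' : IsStieltjes L') (hLL' : ∀ q, L' q = L (X * q)) {n : ℕ} {Q R K : ℝ[X]}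
    (hQ : IsOrthPoly L (n + 1) Q) (hR : IsOrthPoly L n R) (hK : IsOrthPoly L' n K) :
    X * K = Q - C (Q.eval 0 / R.eval 0) * R := by
  have hR0 := hR.ne_zero_at_zero hL
  obtain ⟨G, hG⟩ : X ∣ Q - C (Q.eval 0 / R.eval 0) * R := by
    rw [X_dvd_iff, coeff_zero_eq_eval_zero, eval_sub, eval_mul, eval_C, div_mul_cancel₀ _ hR0,
      sub_self]
  have hlt : (C (Q.eval 0 / R.eval 0) * R).degree < Q.degree := by
    rw [← smul_eq_C_mul]
    refine (degree_smul_le _ _).trans_lt ?_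
    rw [degree_eq_natDegree hQ.monic.ne_zero, degree_eq_natDegree hR.monic.ne_zero,
      hQ.natDegree_eq, hR.natDegree_eq]
    exact_mod_cast Nat.lt_succ_self n
  have hmon : (X * G).Monic := by rw [← hG]; exact hQ.monic.sub_of_left hlt
  have hGm : G.Monic := monic_X.of_mul_monic_left hmon
  have hdeg : (X * G).natDegree = n + 1 := by
    rw [← hG, ← hQ.natDegree_eq]
    exact natDegree_eq_of_degree_eq (degree_sub_eq_left_of_degree_lt hlt)
  rw [natDegree_X_mul hGm.ne_zero] at hdeg
  -- `L' (G q) = L (X G q)`, and `X G` combines `Q` and `R`, both orthogonal to degrees below `n`;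
  -- uniqueness then gives `G = K`.
  have hGo : IsOrthPoly L' n G := by
    refine ⟨hGm, by omega, fun q hq => ?_⟩
    rw [hLL', ← mul_assoc, ← hG, sub_mul, map_sub, mul_assoc, ← smul_eq_C_mul, map_smul,
      hR.orth q hq, hQ.orth q (hq.trans (by exact_mod_cast Nat.lt_succ_self n))]
    simp
  rw [hG, hK.unique hL' hGo]

/-- The zeros lie on both sides of the zero of the linear factor in the relation between orthogonal
polynomials of the weights `w` and `x ^ 2 * w`. -/
theorem between_of_double_kernel {L L' L'' : ℝ[X] →ₗ[ℝ] ℝ} (hL : IsStieltjes L)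
    (hL' : IsStieltjes L') (hL'' : IsStieltjes L'') (hLL' : ∀ q, L' q = L (X * q))
    (hLL'' : ∀ q, L'' q = L' (X * q)) {n : ℕ} {Q₂ Q₁ Q₀ K₁ K₀ S : ℝ[X]}
    (h₂ : IsOrthPoly L (n + 2) Q₂) (h₁ : IsOrthPoly L (n + 1) Q₁) (h₀ : IsOrthPoly L n Q₀)
    (k₁ : IsOrthPoly L' (n + 1) K₁) (k₀ : IsOrthPoly L' n K₀) (hS : IsOrthPoly L'' n S)
    {a b : ℝ} (hrec : X * Q₁ = Q₂ + C a * Q₁ + C b * Q₀) :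
    let d := Q₂.eval 0 / Q₁.eval 0 + K₁.eval 0 / K₀.eval 0
    let e := (Q₁.eval 0 / Q₀.eval 0) * (K₁.eval 0 / K₀.eval 0)
    nthRoot Q₂ 1 < a + d * b / e ∧ a + d * b / e < nthRoot Q₂ (n + 2) := by
  intro d e
  have he : e ≠ 0 := mul_ne_zero
    (div_ne_zero (h₁.ne_zero_at_zero hL) (h₀.ne_zero_at_zero hL))
    (div_ne_zero (k₁.ne_zero_at_zero hL') (k₀.ne_zero_at_zero hL'))
  have e1 := h₂.X_mul_kernel hL hL' hLL' h₁ k₁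
  have e2 := h₁.X_mul_kernel hL hL' hLL' h₀ k₀
  have e3 := k₁.X_mul_kernel hL' hL'' hLL'' k₀ hS
  obtain ⟨c, hc, hquad⟩ := h₂.exists_quadrature hL
  have hx : ∀ j ∈ Finset.Icc 1 (n + 2), 0 < nthRoot Q₂ j := fun j hj =>
    h₂.pos_of_root hL (h₂.eval_nthRoot hL hj)
  refine h₂.between_of_sum_eq_zero hL (by omega)
    (c := fun j => c j * (Q₁.eval (nthRoot Q₂ j) / nthRoot Q₂ j) ^ 2) (fun j hj => ?_) ?_
  · have := div_ne_zero (h₂.prev_ne_zero hL h₁ hj) (hx j hj).ne'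
    have := hc j hj
    positivity
  · have h0 : L (Q₁ * S) = 0 :=
      h₁.orth_of_natDegree_lt (by rw [hS.natDegree_eq]; omega)
    rw [hquad _ (by
      rw [natDegree_mul h₁.monic.ne_zero hS.monic.ne_zero, h₁.natDegree_eq, hS.natDegree_eq]
      omega)] at h0
    have h0' : b / e * ∑ j ∈ Finset.Icc 1 (n + 2), c j * (Q₁ * S).eval (nthRoot Q₂ j) = 0 := by
      rw [h0, mul_zero]
    rw [Finset.mul_sum] at h0'
    rw [← h0']
    refine Finset.sum_congr rfl fun j hj => ?_
    have hxj := (hx j hj).ne'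
    have hz := h₂.eval_nthRoot hL hj
    set x := nthRoot Q₂ j
    have f1 := congrArg (eval x) e1
    have f2 := congrArg (eval x) e2
    have f3 := congrArg (eval x) e3
    have f4 := congrArg (eval x) hrec
    simp only [eval_mul, eval_sub, eval_add, eval_X, eval_C, hz] at f1 f2 f3 f4
    set r₁ := Q₂.eval 0 / Q₁.eval 0 with hr₁
    set r₀ := Q₁.eval 0 / Q₀.eval 0 with hr₀
    set r' := K₁.eval 0 / K₀.eval 0 with hr'
    have hd : d = r₁ + r' := rfl
    have hee : e = r₀ * r' := rfl
    -- Where `Q₂` vanishes, the kernel relations and the recurrence eliminate `K₁`, `K₀` and `Q₀`.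
    -- Hence the mean weighted by `(Q₁ / x)²` becomes a multiple of the quadrature sum for `L (Q₁ S)
    -- = 0`.
    have key : b / e * (x ^ 2 * S.eval x) = (x - (a + d * b / e)) * Q₁.eval x := by
      have : b * (x ^ 2 * S.eval x) = (e * (x - a) - d * b) * Q₁.eval x := by
        rw [hd, hee]
        linear_combination b * x * f3 + b * f1 - b * r' * f2 - r₀ * r' * f4
      field_simp
      linear_combination this
    rw [eval_mul, div_pow]
    field_simp
    field_simp at key
    linear_combination -c j * Q₁.eval x * key

/-! ### Chain sequences and outer bounds. -/

/-- Comparison of a three-term recurrence with the chain sequence `1 / (4 cos² θ)`, whose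
orthogonal polynomials are `sin ((k + 1) θ)` up to normalization. -/
theorem recurrence_comparison {θ : ℝ} {n : ℕ} (hcos : 0 < Real.cos θ)
    (hsin : ∀ k : ℕ, 1 ≤ k → k ≤ n → 0 < Real.sin (k * θ))
    {u b p : ℕ → ℝ} (hu : ∀ k < n, 0 < u k)
    (hb : ∀ k, 1 ≤ k → k < n → 4 * Real.cos θ ^ 2 * b k ≤ u k * u (k - 1))
    (p0 : p 0 = 1) (p1 : p 1 = u 0)
    (hp : ∀ k, k + 1 < n → p (k + 2) = u (k + 1) * p (k + 1) - b (k + 1) * p k) :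
    ∀ k < n, 0 < p k ∧
      u k * p k * Real.sin ((k + 2 : ℕ) * θ)
        ≤ 2 * Real.cos θ * p (k + 1) * Real.sin ((k + 1 : ℕ) * θ) ∧
      (u k * p k * Real.sin ((k + 2 : ℕ) * θ)
          = 2 * Real.cos θ * p (k + 1) * Real.sin ((k + 1 : ℕ) * θ) →
        ∀ i, 1 ≤ i → i ≤ k → 4 * Real.cos θ ^ 2 * b i = u i * u (i - 1)) := by
  -- As quotients, the invariant is `p (k + 1) / (u k * p k) ≥ sin ((k + 2) θ) / (2 cos θ sin ((k +
  -- 1) θ))`. Equality is tracked along the induction for the extremal case.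
  intro k
  induction k with
  | zero =>
    intro _
    have h2 : Real.sin ((2 : ℕ) * θ) = 2 * Real.cos θ * Real.sin ((1 : ℕ) * θ) := by
      push_cast; rw [Real.sin_two_mul, one_mul]; ring
    refine ⟨by rw [p0]; exact one_pos, ?_, fun _ i hi hi' => by omega⟩
    rw [p0, p1, zero_add, zero_add, h2]
    exact le_of_eq (by ring)
  | succ k ih =>
    intro hk
    obtain ⟨hpk, hF, hFeq⟩ := ih (by omega)
    have s1 := hsin (k + 1) (by omega) (by omega)
    have s2 := hsin (k + 2) (by omega) (by omega)
    have hadd : 2 * Real.cos θ * Real.sin ((k + 2 : ℕ) * θ)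
        = Real.sin ((k + 1 : ℕ) * θ) + Real.sin ((k + 3 : ℕ) * θ) := by
      have e1 : ((k + 1 : ℕ) : ℝ) * θ = (k + 2 : ℕ) * θ - θ := by push_cast; ring
      have e3 : ((k + 3 : ℕ) : ℝ) * θ = (k + 2 : ℕ) * θ + θ := by push_cast; ring
      rw [e1, e3, Real.sin_sub, Real.sin_add]; ring
    have hub := hb (k + 1) (by omega) hk
    rw [Nat.add_sub_cancel] at hub
    have hu0 := hu k (by omega)
    have hu1 := hu (k + 1) hk
    have hpk1 : 0 < p (k + 1) := by
      have h1 : 0 < u k * p k * Real.sin ((k + 2 : ℕ) * θ) := by positivity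
      have h2 := h1.trans_le hF
      have h3 : 0 < 2 * Real.cos θ * Real.sin ((k + 1 : ℕ) * θ) := by positivity
      refine pos_of_mul_pos_left (b := 2 * Real.cos θ * Real.sin ((k + 1 : ℕ) * θ)) ?_ h3.le
      linarith
    have hrec := hp k hk
    rw [show k + 1 + 1 = k + 2 from rfl, show k + 1 + 2 = k + 3 from rfl]
    set s₁ := Real.sin ((k + 1 : ℕ) * θ)
    set s₂ := Real.sin ((k + 2 : ℕ) * θ)
    set s₃ := Real.sin ((k + 3 : ℕ) * θ)
    set γ := Real.cos θ
    have i1 : 0 ≤ u (k + 1) * (2 * γ * p (k + 1) * s₁ - u k * p k * s₂) :=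
      mul_nonneg hu1.le (by linarith)
    have i2 : 0 ≤ (u (k + 1) * u k - 4 * γ ^ 2 * b (k + 1)) * (p k * s₂) :=
      mul_nonneg (by linarith) (by positivity)
    -- The defect at `k + 1` is a nonnegative combination of the defect at `k` and the slack in
    -- `hb`, so equality forces both to vanish.
    have expand : 2 * γ * (2 * γ * p (k + 2) * s₂ - u (k + 1) * p (k + 1) * s₃)
        = u (k + 1) * (2 * γ * p (k + 1) * s₁ - u k * p k * s₂)
          + (u (k + 1) * u k - 4 * γ ^ 2 * b (k + 1)) * (p k * s₂) := by
      rw [hrec]; linear_combination 2 * γ * u (k + 1) * p (k + 1) * hadd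
    refine ⟨hpk1, ?_, fun heq => ?_⟩
    · have : 0 ≤ 2 * γ * p (k + 2) * s₂ - u (k + 1) * p (k + 1) * s₃ := by
        refine nonneg_of_mul_nonneg_right ?_ (by positivity : 0 < 2 * γ)
        rw [expand]; exact add_nonneg i1 i2
      linarith
    · have hz : 2 * γ * p (k + 2) * s₂ - u (k + 1) * p (k + 1) * s₃ = 0 := by linarith
      rw [hz, mul_zero] at expand
      have z1 : u (k + 1) * (2 * γ * p (k + 1) * s₁ - u k * p k * s₂) = 0 := by linarith
      have z2 : (u (k + 1) * u k - 4 * γ ^ 2 * b (k + 1)) * (p k * s₂) = 0 := by linarith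
      have z1' : 2 * γ * p (k + 1) * s₁ - u k * p k * s₂ = 0 :=
        (mul_eq_zero.1 z1).resolve_left hu1.ne'
      have z2' : u (k + 1) * u k - 4 * γ ^ 2 * b (k + 1) = 0 :=
        (mul_eq_zero.1 z2).resolve_right (by positivity)
      intro i hi hi'
      rcases hi'.eq_or_lt with rfl | hlt
      · rw [Nat.add_sub_cancel]; linarith
      · exact hFeq (by linarith) i hi (by omega)

/-- If the last term of the recurrence is not positive, then the chain sequence is the extremal
one. -/
theorem eq_of_recurrence_nonpos {n : ℕ} (hn : 2 ≤ n) {u b p : ℕ → ℝ} (hu : ∀ k < n, 0 < u k)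
    (hb : ∀ k, 1 ≤ k → k < n →
      4 * Real.cos (Real.pi / (n + 1)) ^ 2 * b k ≤ u k * u (k - 1))
    (p0 : p 0 = 1) (p1 : p 1 = u 0)
    (hp : ∀ k, k + 1 < n → p (k + 2) = u (k + 1) * p (k + 1) - b (k + 1) * p k)
    (hpn : p n ≤ 0) :
    ∀ k, 1 ≤ k → k < n → 4 * Real.cos (Real.pi / (n + 1)) ^ 2 * b k = u k * u (k - 1) := by
  have hn1 : (2 : ℝ) ≤ n := by exact_mod_cast hn
  set θ := Real.pi / (n + 1) with hθ
  have hπ := Real.pi_pos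
  have hθ0 : 0 < θ := by positivity
  have hθπ : (n + 1 : ℝ) * θ = Real.pi := by rw [hθ]; field_simp
  have hcos : 0 < Real.cos θ := Real.cos_pos_of_mem_Ioo ⟨by linarith, by nlinarith⟩
  have hsin : ∀ k : ℕ, 1 ≤ k → k ≤ n → 0 < Real.sin (k * θ) := by
    intro k h1 h2
    have h1' : (1 : ℝ) ≤ k := by exact_mod_cast h1
    have h2' : (k : ℝ) ≤ n := by exact_mod_cast h2
    exact Real.sin_pos_of_pos_of_lt_pi (by positivity) (by nlinarith)
  obtain ⟨m, rfl⟩ : ∃ m, n = m + 1 := ⟨n - 1, by omega⟩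
  obtain ⟨-, h1, h2⟩ := recurrence_comparison hcos hsin hu hb p0 p1 hp m (by omega)
  -- At the last index `k = n - 1` the sine is `sin ((n + 1) θ) = sin π = 0`, so `p n ≤ 0` turns the
  -- comparison into equality.
  have hs0 : Real.sin ((m + 2 : ℕ) * θ) = 0 := by
    have : ((m + 2 : ℕ) : ℝ) * θ = Real.pi := by rw [← hθπ]; push_cast; ring
    rw [this, Real.sin_pi]
  have hs := hsin (m + 1) (by omega) le_rfl
  intro k hk hk'
  refine h2 (le_antisymm h1 ?_) k hk (by omega)
  rw [hs0, mul_zero]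
  exact mul_nonpos_of_nonpos_of_nonneg (mul_nonpos_of_nonneg_of_nonpos (by positivity) hpn) hs.le

/-- Factorization of the quadratic polynomial whose roots are the lower and upper terms. -/
theorem mul_sub_eq_of_quadratic_roots {x a a' c : ℝ} (hc : 0 ≤ c) :
    (x - (1 / 2 * (a + a') + 1 / 2 * √((a - a') ^ 2 + 4 * c)))
      * (x - (1 / 2 * (a + a') - 1 / 2 * √((a - a') ^ 2 + 4 * c)))
    = (x - a) * (x - a') - c := by
  have := Real.mul_self_sqrt (by positivity : 0 ≤ (a - a') ^ 2 + 4 * c)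
  linear_combination -1 / 4 * this

theorem abs_sub_lt_sqrt {a a' c : ℝ} (hc : 0 < c) : |a - a'| < √((a - a') ^ 2 + 4 * c) := by
  rw [← Real.sqrt_sq_eq_abs]
  exact Real.sqrt_lt_sqrt (sq_nonneg _) (by linarith)

/-- Zeros of a polynomial given by a three-term recurrence, in terms of the roots of the quadratics:
at a point above all of them, the last recurrence value is positive except in the extremal case. -/
theorem eq_of_upper_le {n : ℕ} (hn : 2 ≤ n) {ε : ℝ} (hε : 0 ≤ ε) {a b p : ℕ → ℝ} {x : ℝ}
    (hbpos : ∀ k, 1 ≤ k → k < n → 0 < b k)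
    (hx : ∀ k, 1 ≤ k → k < n →
      1 / 2 * (a k + a (k - 1)) + 1 / 2 * √((a k - a (k - 1)) ^ 2 + 4 * chainC n ε * b k) ≤ x)
    (p0 : p 0 = 1) (p1 : p 1 = x - a 0)
    (hp : ∀ k, k + 1 < n → p (k + 2) = (x - a (k + 1)) * p (k + 1) - b (k + 1) * p k)
    (hpn : p n ≤ 0) :
    ε = 0 ∧ ∀ k, 1 ≤ k → k < n →
      1 / 2 * (a k + a (k - 1)) + 1 / 2 * √((a k - a (k - 1)) ^ 2 + 4 * chainC n ε * b k) = x := by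
  have hn1 : (2 : ℝ) ≤ n := by exact_mod_cast hn
  have hcos : 0 < Real.cos (Real.pi / (n + 1)) := by
    have hπ := Real.pi_pos
    have h1 : 0 < Real.pi / (n + 1) := by positivity
    refine Real.cos_pos_of_mem_Ioo ⟨by linarith, ?_⟩
    rw [div_lt_div_iff₀ (by positivity) two_pos]; nlinarith
  have hc : 0 < chainC n ε := by unfold chainC; positivity
  have hcb : ∀ k, 1 ≤ k → k < n → 0 < chainC n ε * b k := fun k h1 h2 => mul_pos hc (hbpos k h1 h2)
  -- The larger root of each quadratic exceeds both diagonal coefficients, because its square root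
  -- exceeds their distance.
  have hgap : ∀ k, 1 ≤ k → k < n → a k < x ∧ a (k - 1) < x := by
    intro k h1 h2
    have h3 := hx k h1 h2
    have h4 := abs_sub_lt_sqrt (a := a k) (a' := a (k - 1)) (hcb k h1 h2)
    rw [← mul_assoc] at h4
    rw [abs_lt] at h4
    constructor <;> linarith
  have hu : ∀ k < n, 0 < x - a k := by
    intro k hk
    rcases Nat.eq_zero_or_pos k with rfl | hk0
    · exact sub_pos.2 (hgap 1 le_rfl (by omega)).2
    · exact sub_pos.2 (hgap k hk0 hk).1
  have hfac : ∀ k, 1 ≤ k → k < n → chainC n ε * b k ≤ (x - a k) * (x - a (k - 1)) := by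
    intro k h1 h2
    have h3 := hx k h1 h2
    have h4 := mul_sub_eq_of_quadratic_roots (x := x) (a := a k) (a' := a (k - 1)) (hcb k h1 h2).le
    rw [← mul_assoc] at h4
    have h5 := Real.sqrt_nonneg ((a k - a (k - 1)) ^ 2 + 4 * chainC n ε * b k)
    have h6 := mul_nonneg (sub_nonneg.2 h3) (a := x - _) (b := x - (1 / 2 * (a k + a (k - 1)) - 1 / 2 *
      √((a k - a (k - 1)) ^ 2 + 4 * chainC n ε * b k))) (by linarith)
    linarith
  have hle : ∀ k, 1 ≤ k → k < n →
      4 * Real.cos (Real.pi / (n + 1)) ^ 2 * b k ≤ chainC n ε * b k := by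
    intro k h1 h2
    have := mul_nonneg hε (hbpos k h1 h2).le
    unfold chainC; linarith
  have heq := eq_of_recurrence_nonpos hn hu (fun k h1 h2 => (hle k h1 h2).trans (hfac k h1 h2))
    p0 p1 hp hpn
  refine ⟨?_, fun k h1 h2 => ?_⟩
  -- Because `n ≥ 2`, the index `1` is available; there `c_n b₁ ≤ 4 cos² θ b₁` with `b₁ > 0` forces
  -- `ε ≤ 0`.
  · have h1 := heq 1 le_rfl (by omega)
    have h2 := hfac 1 le_rfl (by omega)
    have h3 := hbpos 1 le_rfl (by omega)
    rw [← h1] at h2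
    have h4 := le_of_mul_le_mul_right h2 h3
    unfold chainC at h4
    linarith
  · have h3 := (hfac k h1 h2).antisymm ((heq k h1 h2).ge.trans (hle k h1 h2))
    have h4 := mul_sub_eq_of_quadratic_roots (x := x) (a := a k) (a' := a (k - 1)) (hcb k h1 h2).le
    rw [← mul_assoc, h3, sub_self] at h4
    rcases mul_eq_zero.1 h4 with h5 | h5
    · linarith
    -- If `x` is the smaller root, then `x` being at least the larger one makes the two coincide.
    · have h6 := hx k h1 h2
      have h7 := Real.sqrt_nonneg ((a k - a (k - 1)) ^ 2 + 4 * chainC n ε * b k)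
      linarith

/-- The counterpart of `eq_of_upper_le` at a point below all the roots of the quadratics. -/
theorem eq_of_le_lower {n : ℕ} (hn : 2 ≤ n) {ε : ℝ} (hε : 0 ≤ ε) {a b p : ℕ → ℝ} {x : ℝ}
    (hbpos : ∀ k, 1 ≤ k → k < n → 0 < b k)
    (hx : ∀ k, 1 ≤ k → k < n →
      x ≤ 1 / 2 * (a k + a (k - 1)) - 1 / 2 * √((a k - a (k - 1)) ^ 2 + 4 * chainC n ε * b k))
    (p0 : p 0 = 1) (p1 : p 1 = x - a 0)
    (hp : ∀ k, k + 1 < n → p (k + 2) = (x - a (k + 1)) * p (k + 1) - b (k + 1) * p k)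
    (hpn : p n = 0) :
    ε = 0 ∧ ∀ k, 1 ≤ k → k < n →
      1 / 2 * (a k + a (k - 1)) - 1 / 2 * √((a k - a (k - 1)) ^ 2 + 4 * chainC n ε * b k) = x := by
  have hsq : ∀ k, (-a k - -a (k - 1)) ^ 2 = (a k - a (k - 1)) ^ 2 := fun k => by ring
  -- Reflection `x ↦ -x` sends `p_k` to `(-1)^k p_k` and `a_k` to `-a_k`, keeps `b_k`, and exchanges
  -- lower and upper roots.
  have := eq_of_upper_le (a := fun k => -a k) (b := b) (p := fun k => (-1) ^ k * p k) (x := -x)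
    hn hε hbpos (fun k h1 h2 => by simp only [hsq]; linarith [hx k h1 h2]) (by simp [p0])
    (by simp only [p1]; ring) (fun k hk => by simp only [hp k hk]; ring) (by simp [hpn])
  refine ⟨this.1, fun k h1 h2 => ?_⟩
  have h3 := this.2 k h1 h2
  simp only [hsq] at h3
  linarith

/-! ### Weights on the half-line and Markov's theorem. -/

open MeasureTheory

/-- A positive weight on `(0, ∞)` all of whose moments exist. -/
structure IsWeight (w : ℝ → ℝ) : Prop where
  pos : ∀ x, 0 < x → 0 < w x
  integrable_pow : ∀ k : ℕ, IntegrableOn (fun x => x ^ k * w x) (Set.Ioi 0)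

theorem setIntegral_Ioi_pos {f : ℝ → ℝ} (hf : IntegrableOn f (Set.Ioi 0)) {s : Set ℝ}
    (hs : s.Finite) (h0 : ∀ x, 0 < x → 0 ≤ f x) (hne : ∀ x, 0 < x → x ∉ s → f x ≠ 0) :
    0 < ∫ x in Set.Ioi 0, f x := by
  rw [setIntegral_pos_iff_support_of_nonneg_ae
    ((ae_restrict_iff' measurableSet_Ioi).2 (ae_of_all _ h0)) hf]
  have hsub : Set.Ioi 0 \ s ⊆ Function.support f ∩ Set.Ioi 0 := fun x hx =>
    ⟨hne x hx.1 hx.2, hx.1⟩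
  refine lt_of_lt_of_le ?_ (measure_mono hsub)
  rw [measure_sdiff_null (hs.measure_zero volume), Real.volume_Ioi]
  exact ENNReal.zero_lt_top

namespace IsWeight

variable {w : ℝ → ℝ}

theorem integrable (hw : IsWeight w) (p : ℝ[X]) :
    IntegrableOn (fun x => p.eval x * w x) (Set.Ioi 0) := by
  have : (fun x => p.eval x * w x)
      = fun x => ∑ i ∈ Finset.range (p.natDegree + 1), p.coeff i * (x ^ i * w x) := by
    ext x; rw [eval_eq_sum_range, Finset.sum_mul]
    exact Finset.sum_congr rfl fun i _ => by ring
  rw [this]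
  exact integrable_finsetSum _ fun i _ => (hw.integrable_pow i).const_mul _

/-- Integration against a weight. -/
def functional (hw : IsWeight w) : ℝ[X] →ₗ[ℝ] ℝ where
  toFun p := ∫ x in Set.Ioi 0, p.eval x * w x
  map_add' p q := by
    rw [← integral_add (hw.integrable p) (hw.integrable q)]
    simp only [eval_add, add_mul]
  map_smul' c p := by
    simp only [RingHom.id_apply, smul_eq_mul]
    rw [← integral_const_mul]
    simp only [eval_smul, smul_eq_mul, mul_assoc]

theorem functional_apply (hw : IsWeight w) (p : ℝ[X]) :
    hw.functional p = ∫ x in Set.Ioi 0, p.eval x * w x := rfl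

theorem inner_eq (hw : IsWeight w) (p q : ℝ[X]) : inner w p q = hw.functional (p * q) := by
  simp only [inner, functional_apply, eval_mul]

theorem isStieltjes (hw : IsWeight w) : IsStieltjes hw.functional := by
  constructor
  · intro p hp
    refine setIntegral_Ioi_pos (hw.integrable _) (finite_setOfPred_isRoot hp) (fun x hx => ?_)
      fun x hx hxs => ?_
    · rw [eval_mul]; exact mul_nonneg (mul_self_nonneg _) (hw.pos x hx).le
    · exact mul_ne_zero (by rw [eval_mul]; exact mul_self_ne_zero.2 hxs) (hw.pos x hx).ne'
  · intro p hp
    refine setIntegral_Ioi_pos (hw.integrable _) (finite_setOfPred_isRoot hp) (fun x hx => ?_)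
      fun x hx hxs => ?_
    · rw [eval_mul, eval_mul, eval_X]
      exact mul_nonneg (mul_nonneg hx.le (mul_self_nonneg _)) (hw.pos x hx).le
    · rw [eval_mul, eval_mul, eval_X]
      exact mul_ne_zero (mul_ne_zero hx.ne' (mul_self_ne_zero.2 hxs)) (hw.pos x hx).ne'

theorem isOrthPoly_monicOP (hw : IsWeight w) (n : ℕ) :
    IsOrthPoly hw.functional n (monicOP w n) := by
  refine isOrthPoly_of_gramSchmidt hw.isStieltjes (p := monicOP w) (fun n => ?_) n
  rw [monicOP]
  simp only [hw.inner_eq]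

/-- Markov's monotonicity theorem: the zeros increase when the weight is multiplied by a strictly
increasing function. -/
theorem nthRoot_lt_nthRoot {w' : ℝ → ℝ} (hw : IsWeight w) (hw' : IsWeight w')
    (hratio : ∀ ξ x, 0 < ξ → ξ < x → w' ξ * w x < w' x * w ξ) {n j : ℕ} {Q R : ℝ[X]}
    (hQ : IsOrthPoly hw.functional n Q) (hR : IsOrthPoly hw'.functional n R)
    (hj : 1 ≤ j) (hjn : j ≤ n) : nthRoot Q j < nthRoot R j := by
  have hL := hw.isStieltjes
  have hL' := hw'.isStieltjes
  obtain ⟨c, hc, hquad⟩ := hQ.exists_quadrature hL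
  obtain ⟨c', hc', hquad'⟩ := hR.exists_quadrature hL'
  have hmQ := hQ.strictMonoOn hL
  have hmR := hR.strictMonoOn hL'
  -- `F` vanishes at the zeros of `Q` below index `j` and at those of `R` above it. Its degree is `n
  -- - 1`, so `(X - a) F²` has degree `2 n - 1` and both quadratures apply.
  set F := Lagrange.nodal (Finset.Icc (j + 1) n) (nthRoot R)
    * Lagrange.nodal (Finset.Icc 1 (j - 1)) (nthRoot Q) with hF
  have hF0 : F ≠ 0 := mul_ne_zero Lagrange.nodal_ne_zero Lagrange.nodal_ne_zero
  have hFd : F.natDegree = n - 1 := by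
    rw [hF, natDegree_mul Lagrange.nodal_ne_zero Lagrange.nodal_ne_zero, Lagrange.natDegree_nodal,
      Lagrange.natDegree_nodal]
    simp; omega
  have hdeg : ∀ a : ℝ, ((X - C a) * (F * F)).natDegree < 2 * n := fun a => by
    rw [natDegree_mul (X_sub_C_ne_zero a) (mul_ne_zero hF0 hF0), natDegree_X_sub_C,
      natDegree_mul hF0 hF0, hFd]; omega
  have h1 : 0 ≤ hw.functional ((X - C (nthRoot Q j)) * (F * F)) := by
    rw [hquad _ (hdeg _)]
    refine Finset.sum_nonneg fun i hi => mul_nonneg (hc i hi).le ?_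
    rw [Finset.mem_Icc] at hi
    rw [eval_mul, eval_mul, eval_sub, eval_X, eval_C]
    rcases lt_or_ge i j with hij | hij
    · have : F.eval (nthRoot Q i) = 0 := by
        rw [hF, eval_mul, Lagrange.eval_nodal_at_node (v := nthRoot Q)
          (Finset.mem_Icc.2 ⟨hi.1, by omega⟩), mul_zero]
      rw [this]; simp
    · exact mul_nonneg (sub_nonneg.2 (hmQ.monotoneOn ⟨hj, hjn⟩ hi hij)) (mul_self_nonneg _)
  have h2 : hw'.functional ((X - C (nthRoot R j)) * (F * F)) ≤ 0 := by
    rw [hquad' _ (hdeg _)]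
    refine Finset.sum_nonpos fun i hi => mul_nonpos_of_nonneg_of_nonpos (hc' i hi).le ?_
    rw [Finset.mem_Icc] at hi
    rw [eval_mul, eval_mul, eval_sub, eval_X, eval_C]
    rcases lt_or_ge j i with hij | hij
    · have : F.eval (nthRoot R i) = 0 := by
        rw [hF, eval_mul, Lagrange.eval_nodal_at_node (v := nthRoot R)
          (Finset.mem_Icc.2 ⟨hij, hi.2⟩), zero_mul]
      rw [this]; simp
    · exact mul_nonpos_of_nonpos_of_nonneg
        (sub_nonpos.2 (hmR.monotoneOn hi ⟨hj, hjn⟩ hij)) (mul_self_nonneg _)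
  by_contra hcon
  rw [not_lt] at hcon
  set ξ := nthRoot Q j with hξ
  have hξ0 : 0 < ξ := hQ.pos_of_root hL (hQ.eval_nthRoot hL (Finset.mem_Icc.2 ⟨hj, hjn⟩))
  set G := (X - C ξ) * (F * F) with hG
  -- Under the contrary assumption, moving the base point up to `ξ` can only decrease the value, as
  -- `L' (F²) > 0`.
  have h3 : hw'.functional G ≤ 0 := by
    have e : G = (X - C (nthRoot R j)) * (F * F) + (nthRoot R j - ξ) • (F * F) := by
      rw [hG, smul_eq_C_mul, C_sub]; ring
    rw [e, map_add, map_smul, smul_eq_mul]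
    have := mul_nonneg (sub_nonneg.2 hcon) (hL'.pos F hF0).le
    linarith
  have h4 : w ξ * hw'.functional G - w' ξ * hw.functional G
      = ∫ x in Set.Ioi 0, (w ξ * (G.eval x * w' x) - w' ξ * (G.eval x * w x)) := by
    rw [functional_apply, functional_apply, integral_sub ((hw'.integrable G).const_mul _)
      ((hw.integrable G).const_mul _), integral_const_mul, integral_const_mul]
  have hGx : ∀ x, w ξ * (G.eval x * w' x) - w' ξ * (G.eval x * w x)
      = (x - ξ) * (w' x * w ξ - w' ξ * w x) * (F.eval x * F.eval x) := fun x => by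
    rw [hG, eval_mul, eval_mul, eval_sub, eval_X, eval_C]; ring
  have hsign : ∀ x, 0 < x → x ≠ ξ → 0 < (x - ξ) * (w' x * w ξ - w' ξ * w x) := by
    intro x hx hne
    rcases lt_or_gt_of_ne hne with h | h
    · have := hratio x ξ hx h
      exact mul_pos_of_neg_of_neg (by linarith) (by linarith)
    · have := hratio ξ x hξ0 h
      exact mul_pos (by linarith) (by linarith)
  -- The increasing ratio `w' / w` makes the integrand nonnegative, with finitely many zeros; this
  -- contradicts `h1` and `h3`.
  have h5 : 0 < w ξ * hw'.functional G - w' ξ * hw.functional G := by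
    rw [h4]
    refine setIntegral_Ioi_pos (((hw'.integrable G).const_mul _).sub
      ((hw.integrable G).const_mul _)) (s := insert ξ (F.rootSet ℝ))
      ((rootSet_finite F ℝ).insert ξ) (fun x hx => ?_) fun x hx hxs => ?_
    · rw [hGx]
      rcases eq_or_ne x ξ with rfl | hne
      · simp
      · exact mul_nonneg (hsign x hx hne).le (mul_self_nonneg _)
    · rw [Set.mem_insert_iff, not_or, mem_rootSet] at hxs
      rw [hGx]
      refine mul_ne_zero (hsign x hx hxs.1).ne' (mul_self_ne_zero.2 fun h => hxs.2 ⟨hF0, ?_⟩)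
      simpa using h
  have h6 := mul_nonneg (hw.pos ξ hξ0).le (neg_nonneg.2 h3)
  have h7 := mul_nonneg (hw'.pos ξ hξ0).le h1
  linarith

end IsWeight

/-! ### The weights `x ^ α * exp (-x - t / x)` and their polynomials. -/

/-- Since `t / x ≥ 0`, the moments are dominated by the Gamma integral at `α + k + 1 > 0`. -/
theorem isWeight_weight {t α : ℝ} (ht : 0 ≤ t) (hα : -1 < α) : IsWeight (weight t α) := by
  constructor
  · intro x hx; unfold weight; positivity
  · intro k
    have hk : (0 : ℝ) ≤ k := Nat.cast_nonneg k
    have hG := Real.GammaIntegral_convergent (s := α + k + 1) (by linarith)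
    refine Integrable.mono' hG ?_ ((ae_restrict_iff' measurableSet_Ioi).2 (ae_of_all _ ?_))
    · refine ContinuousOn.aestronglyMeasurable ?_ measurableSet_Ioi
      unfold weight
      refine ContinuousOn.mul (by fun_prop) (ContinuousOn.mul ?_ ?_)
      · exact fun x hx => (Real.continuousAt_rpow_const x α (.inl (ne_of_gt hx))).continuousWithinAt
      · refine Real.continuous_exp.comp_continuousOn (ContinuousOn.sub (by fun_prop) ?_)
        exact continuousOn_const.div continuousOn_id fun x hx => ne_of_gt hx
    · intro x hx
      have hx : 0 < x := hx
      have h0 : 0 ≤ x ^ k * weight t α x := by unfold weight; positivity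
      rw [Real.norm_of_nonneg h0, weight, add_sub_cancel_right, Real.rpow_add hx, Real.rpow_natCast]
      have : Real.exp (-x - t / x) ≤ Real.exp (-x) :=
        Real.exp_le_exp.2 (by have := div_nonneg ht hx.le; linarith)
      calc x ^ k * (x ^ α * Real.exp (-x - t / x)) ≤ x ^ k * (x ^ α * Real.exp (-x)) := by gcongr
        _ = Real.exp (-x) * (x ^ α * x ^ k) := by ring

/-- The ratio of the weights is `x ^ (α' - α)`, strictly increasing. -/
theorem weight_ratio_alpha (t : ℝ) {α α' : ℝ} (h : α < α') {ξ x : ℝ} (hξ : 0 < ξ) (hx : ξ < x) :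
    weight t α' ξ * weight t α x < weight t α' x * weight t α ξ := by
  have hx0 : 0 < x := hξ.trans hx
  have e : ∀ y : ℝ, 0 < y → weight t α' y = y ^ (α' - α) * weight t α y := fun y hy => by
    rw [weight, weight, ← mul_assoc, ← Real.rpow_add hy, sub_add_cancel]
  have h1 : 0 < weight t α ξ := by unfold weight; positivity
  have h2 : 0 < weight t α x := by unfold weight; positivity
  rw [e ξ hξ, e x hx0, mul_assoc, mul_assoc, mul_comm (weight t α ξ)]
  exact mul_lt_mul_of_pos_right (Real.rpow_lt_rpow hξ.le hx (by linarith)) (by positivity)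

/-- The ratio of the weights is `exp (-(t' - t) / x)`, strictly increasing. -/
theorem weight_ratio_t (α : ℝ) {t t' : ℝ} (h : t < t') {ξ x : ℝ} (hξ : 0 < ξ) (hx : ξ < x) :
    weight t' α ξ * weight t α x < weight t' α x * weight t α ξ := by
  have hx0 : 0 < x := hξ.trans hx
  have hlt : t' / ξ + t / x > t' / x + t / ξ := by
    have h1 : (t' - t) / x < (t' - t) / ξ := div_lt_div_of_pos_left (by linarith) hξ hx
    rw [sub_div, sub_div] at h1; linarith
  have h2 : 0 < ξ ^ α * x ^ α := by positivity
  calc weight t' α ξ * weight t α x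
      = ξ ^ α * x ^ α * Real.exp (-ξ - t' / ξ + (-x - t / x)) := by
        rw [Real.exp_add]; unfold weight; ring
    _ < ξ ^ α * x ^ α * Real.exp (-x - t' / x + (-ξ - t / ξ)) :=
        mul_lt_mul_of_pos_left (Real.exp_lt_exp.2 (by linarith)) h2
    _ = weight t' α x * weight t α ξ := by rw [Real.exp_add]; unfold weight; ring

theorem functional_weight_add_one {t α : ℝ} (hw : IsWeight (weight t α))
    (hw' : IsWeight (weight t (α + 1))) (q : ℝ[X]) :
    hw'.functional q = hw.functional (X * q) := by
  rw [IsWeight.functional_apply, IsWeight.functional_apply]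
  refine setIntegral_congr_fun measurableSet_Ioi fun x hx => ?_
  have hx : x ≠ 0 := ne_of_gt hx
  simp only [weight, eval_mul, eval_X, Real.rpow_add_one hx]
  ring

section

variable {t α : ℝ}

theorem isOrthPoly_P (hw : IsWeight (weight t α)) (n : ℕ) :
    IsOrthPoly hw.functional n (P n t α) := hw.isOrthPoly_monicOP n

theorem h_eq (hw : IsWeight (weight t α)) (n : ℕ) :
    h n t α = hw.functional (P n t α * P n t α) := hw.inner_eq _ _

theorem recA_eq (hw : IsWeight (weight t α)) (n : ℕ) :
    recA n t α = hw.functional (X * P n t α * P n t α) / hw.functional (P n t α * P n t α) := by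
  rw [recA, h_eq hw, hw.inner_eq]

theorem recB_succ_eq (hw : IsWeight (weight t α)) (n : ℕ) :
    recB (n + 1) t α
      = hw.functional (X * P (n + 1) t α * P n t α) / hw.functional (P n t α * P n t α) := by
  rw [recB, h_eq hw, hw.inner_eq]

theorem recB_pos (hw : IsWeight (weight t α)) {n : ℕ} (hn : 1 ≤ n) : 0 < recB n t α := by
  obtain ⟨m, rfl⟩ : ∃ m, n = m + 1 := ⟨n - 1, by omega⟩
  rw [recB_succ_eq hw]
  exact div_pos (apply_X_mul_succ_mul_pos hw.isStieltjes (isOrthPoly_P hw) m)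
    ((isOrthPoly_P hw m).pos_self hw.isStieltjes)

theorem X_mul_P_zero (hw : IsWeight (weight t α)) :
    X * P 0 t α = P 1 t α + C (recA 0 t α) * P 0 t α := by
  rw [recA_eq hw]
  exact recurrence_zero hw.isStieltjes (isOrthPoly_P hw)

theorem X_mul_P_succ (hw : IsWeight (weight t α)) (n : ℕ) :
    X * P (n + 1) t α = P (n + 2) t α + C (recA (n + 1) t α) * P (n + 1) t α
      + C (recB (n + 1) t α) * P n t α := by
  rw [recA_eq hw, recB_succ_eq hw]
  exact recurrence_succ hw.isStieltjes (isOrthPoly_P hw) n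

theorem eval_P_zero (hw : IsWeight (weight t α)) (x : ℝ) : (P 0 t α).eval x = 1 := by
  rw [(isOrthPoly_P hw 0).monic.natDegree_eq_zero.1 (isOrthPoly_P hw 0).natDegree_eq, eval_one]

theorem eval_P_one (hw : IsWeight (weight t α)) (x : ℝ) :
    (P 1 t α).eval x = x - recA 0 t α := by
  have := congrArg (eval x) (X_mul_P_zero hw)
  simp only [eval_mul, eval_add, eval_X, eval_C, eval_P_zero hw] at this
  linarith

theorem eval_P_add_two (hw : IsWeight (weight t α)) (x : ℝ) (k : ℕ) :
    (P (k + 2) t α).eval x = (x - recA (k + 1) t α) * (P (k + 1) t α).eval x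
      - recB (k + 1) t α * (P k t α).eval x := by
  have := congrArg (eval x) (X_mul_P_succ hw k)
  simp only [eval_mul, eval_add, eval_X, eval_C] at this
  linarith

theorem eval_P_zero_eq_zero (hw : IsWeight (weight t α)) {n j : ℕ} (hj : j ∈ Finset.Icc 1 n) :
    (P n t α).eval (zero n j t α) = 0 := (isOrthPoly_P hw n).eval_nthRoot hw.isStieltjes hj

/-- Assuming the inequality opposite to the bound serves twice: it proves the bound by contradiction
and settles the case of equality. -/
theorem eq_of_zero_le_outerLower (hw : IsWeight (weight t α)) {n : ℕ} (hn : 2 ≤ n) {ε : ℝ}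
    (hε : 0 ≤ ε) (hle : zero n 1 t α ≤ outerLower hn ε t α) :
    ε = 0 ∧ ∀ k ∈ Finset.Icc 1 (n - 1), lowerTerm (chainC n ε) t α k = zero n 1 t α := by
  have hx : ∀ k, 1 ≤ k → k < n → zero n 1 t α ≤ lowerTerm (chainC n ε) t α k := fun k h1 h2 =>
    hle.trans (Finset.inf'_le _ (Finset.mem_Icc.2 ⟨h1, by omega⟩))
  obtain ⟨h1, h2⟩ := eq_of_le_lower (a := fun k => recA k t α) (b := fun k => recB k t α)
    (p := fun k => (P k t α).eval (zero n 1 t α)) hn hε (fun k h1 _ => recB_pos hw h1) hx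
    (eval_P_zero hw _) (eval_P_one hw _) (fun k _ => eval_P_add_two hw _ k)
    (eval_P_zero_eq_zero hw (Finset.mem_Icc.2 ⟨le_rfl, by omega⟩))
  exact ⟨h1, fun k hk => h2 k (Finset.mem_Icc.1 hk).1 (by rw [Finset.mem_Icc] at hk; omega)⟩

theorem eq_of_outerUpper_le_zero (hw : IsWeight (weight t α)) {n : ℕ} (hn : 2 ≤ n) {ε : ℝ}
    (hε : 0 ≤ ε) (hle : outerUpper hn ε t α ≤ zero n n t α) :
    ε = 0 ∧ ∀ k ∈ Finset.Icc 1 (n - 1), upperTerm (chainC n ε) t α k = zero n n t α := by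
  have hx : ∀ k, 1 ≤ k → k < n → upperTerm (chainC n ε) t α k ≤ zero n n t α := fun k h1 h2 =>
    (Finset.le_sup' _ (Finset.mem_Icc.2 ⟨h1, by omega⟩)).trans hle
  obtain ⟨h1, h2⟩ := eq_of_upper_le (a := fun k => recA k t α) (b := fun k => recB k t α)
    (p := fun k => (P k t α).eval (zero n n t α)) hn hε (fun k h1 _ => recB_pos hw h1) hx
    (eval_P_zero hw _) (eval_P_one hw _) (fun k _ => eval_P_add_two hw _ k)
    (eval_P_zero_eq_zero hw (Finset.mem_Icc.2 ⟨by omega, le_rfl⟩)).le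
  exact ⟨h1, fun k hk => h2 k (Finset.mem_Icc.1 hk).1 (by rw [Finset.mem_Icc] at hk; omega)⟩

theorem outerLower_le_zero (hw : IsWeight (weight t α)) {n : ℕ} (hn : 2 ≤ n) {ε : ℝ}
    (hε : 0 ≤ ε) : outerLower hn ε t α ≤ zero n 1 t α := by
  by_contra hcon
  have := (eq_of_zero_le_outerLower hw hn hε (not_le.1 hcon).le).2
  refine hcon ?_
  have hm : 1 ∈ Finset.Icc 1 (n - 1) := Finset.mem_Icc.2 ⟨le_rfl, by omega⟩
  rw [← this 1 hm]
  exact Finset.inf'_le _ hm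

theorem zero_le_outerUpper (hw : IsWeight (weight t α)) {n : ℕ} (hn : 2 ≤ n) {ε : ℝ}
    (hε : 0 ≤ ε) : zero n n t α ≤ outerUpper hn ε t α := by
  by_contra hcon
  have := (eq_of_outerUpper_le_zero hw hn hε (not_le.1 hcon).le).2
  refine hcon ?_
  have hm : 1 ∈ Finset.Icc 1 (n - 1) := Finset.mem_Icc.2 ⟨le_rfl, by omega⟩
  rw [← this 1 hm]
  exact Finset.le_sup' _ hm

theorem zero_lt_zero_of_alpha_lt {α' : ℝ} (ht : 0 ≤ t) (hα : -1 < α) (h : α < α') {n j : ℕ}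
    (hj : 1 ≤ j) (hjn : j ≤ n) : zero n j t α < zero n j t α' := by
  have hw := isWeight_weight ht hα
  have hw' := isWeight_weight ht (hα.trans h)
  exact hw.nthRoot_lt_nthRoot hw' (fun _ _ => weight_ratio_alpha t h) (isOrthPoly_P hw n)
    (isOrthPoly_P hw' n) hj hjn

theorem zero_lt_zero_of_t_lt {t' : ℝ} (ht : 0 ≤ t) (hα : -1 < α) (h : t < t') {n j : ℕ}
    (hj : 1 ≤ j) (hjn : j ≤ n) : zero n j t α < zero n j t' α := by
  have hw := isWeight_weight ht hα
  have hw' := isWeight_weight (ht.trans h.le) hα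
  exact hw.nthRoot_lt_nthRoot hw' (fun _ _ => weight_ratio_t α h) (isOrthPoly_P hw n)
    (isOrthPoly_P hw' n) hj hjn

theorem zero_between_recA (hw : IsWeight (weight t α)) {n : ℕ} (hn : 2 ≤ n) :
    zero n 1 t α < recA (n - 1) t α ∧ recA (n - 1) t α < zero n n t α := by
  obtain ⟨m, rfl⟩ : ∃ m, n = m + 1 := ⟨n - 1, by omega⟩
  rw [Nat.add_sub_cancel, recA_eq hw]
  exact (isOrthPoly_P hw (m + 1)).between_recurrence_coeff hw.isStieltjes (isOrthPoly_P hw m)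
    (by omega)

theorem zero_between_double_kernel (ht : 0 ≤ t) (hα : -1 < α) {n : ℕ} (hn : 2 ≤ n) :
    zero n 1 t α < recA (n - 1) t α + d n t α * recB (n - 1) t α / e n t α ∧
      recA (n - 1) t α + d n t α * recB (n - 1) t α / e n t α < zero n n t α := by
  obtain ⟨m, rfl⟩ : ∃ m, n = m + 2 := ⟨n - 2, by omega⟩
  have hw := isWeight_weight ht hα
  have hw' := isWeight_weight ht (show -1 < α + 1 by linarith)
  have hw'' := isWeight_weight ht (show -1 < α + 1 + 1 by linarith)
  exact between_of_double_kernel hw.isStieltjes hw'.isStieltjes hw''.isStieltjes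
    (functional_weight_add_one hw hw') (functional_weight_add_one hw' hw'')
    (isOrthPoly_P hw (m + 2)) (isOrthPoly_P hw (m + 1)) (isOrthPoly_P hw m)
    (isOrthPoly_P hw' (m + 1)) (isOrthPoly_P hw' m) (isOrthPoly_P hw'' m) (X_mul_P_succ hw m)

end

end SPLaguerre

end

/-- The first block says that `P n t α` are the monic orthogonal polynomials of the weight and that
`recA`, `recB` are the coefficients of their three-term recurrence. -/
theorem theorem3p1 :
    (∀ t α : ℝ, 0 ≤ t → -1 < α →
      (∀ n : ℕ, (SPLaguerre.P n t α).Monic ∧ (SPLaguerre.P n t α).natDegree = n ∧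
        0 < SPLaguerre.h n t α) ∧
      (∀ j k : ℕ, j ≠ k →
        ∫ x in Set.Ioi (0 : ℝ), (SPLaguerre.P j t α).eval x * (SPLaguerre.P k t α).eval x
          * SPLaguerre.weight t α x = 0) ∧
      X * SPLaguerre.P 0 t α
        = SPLaguerre.P 1 t α + C (SPLaguerre.recA 0 t α) * SPLaguerre.P 0 t α ∧
      (∀ n : ℕ, 1 ≤ n → X * SPLaguerre.P n t α
        = SPLaguerre.P (n + 1) t α + C (SPLaguerre.recA n t α) * SPLaguerre.P n t α
          + C (SPLaguerre.recB n t α) * SPLaguerre.P (n - 1) t α)) ∧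
    -- (i) the zeros are real, simple, positive, and interlace with those of the previous polynomial
    (∀ t α : ℝ, 0 ≤ t → -1 < α → ∀ n : ℕ, 1 ≤ n →
      (∀ z : ℂ, aeval z (SPLaguerre.P n t α) = 0 →
        ∃ j ∈ Finset.Icc 1 n, z = (SPLaguerre.zero n j t α : ℂ)) ∧
      SPLaguerre.P n t α = ∏ j ∈ Finset.Icc 1 n, (X - C (SPLaguerre.zero n j t α)) ∧
      (∀ j : ℕ, 1 ≤ j → j < n → SPLaguerre.zero n j t α < SPLaguerre.zero n (j + 1) t α) ∧
      0 < SPLaguerre.zero n 1 t α ∧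
      (∀ j : ℕ, 1 ≤ j → j < n →
        SPLaguerre.zero n j t α < SPLaguerre.zero (n - 1) j t α ∧
        SPLaguerre.zero (n - 1) j t α < SPLaguerre.zero n (j + 1) t α)) ∧
    -- (ii) every zero strictly increases with `α` and with `t`
    (∀ n j : ℕ, 1 ≤ j → j ≤ n →
      (∀ t : ℝ, 0 ≤ t → StrictMonoOn (fun α => SPLaguerre.zero n j t α) (Set.Ioi (-1))) ∧
      (∀ α : ℝ, -1 < α → StrictMonoOn (fun t => SPLaguerre.zero n j t α) (Set.Ici 0))) ∧
    -- (iii) outer bounds (with the only possible case of equality) and the first inner bound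
    (∀ t α : ℝ, 0 ≤ t → -1 < α → ∀ (n : ℕ) (hn : 2 ≤ n),
      (∀ ε : ℝ, 0 ≤ ε →
        SPLaguerre.outerLower hn ε t α ≤ SPLaguerre.zero n 1 t α ∧
        (SPLaguerre.outerLower hn ε t α = SPLaguerre.zero n 1 t α → ε = 0 ∧
          ∀ k ∈ Finset.Icc 1 (n - 1),
            SPLaguerre.lowerTerm (SPLaguerre.chainC n ε) t α k
              = SPLaguerre.outerLower hn ε t α) ∧
        SPLaguerre.zero n n t α ≤ SPLaguerre.outerUpper hn ε t α ∧
        (SPLaguerre.zero n n t α = SPLaguerre.outerUpper hn ε t α → ε = 0 ∧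
          ∀ k ∈ Finset.Icc 1 (n - 1),
            SPLaguerre.upperTerm (SPLaguerre.chainC n ε) t α k
              = SPLaguerre.outerUpper hn ε t α)) ∧
      SPLaguerre.zero n 1 t α < SPLaguerre.recA (n - 1) t α ∧
      SPLaguerre.recA (n - 1) t α < SPLaguerre.zero n n t α) ∧
    -- (iv) the second inner bound
    (∀ t α : ℝ, 0 ≤ t → -1 < α → ∀ n : ℕ, 2 ≤ n →
      0 < SPLaguerre.zero n 1 t α ∧
      SPLaguerre.zero n 1 t α
        < SPLaguerre.recA (n - 1) t α
          + SPLaguerre.d n t α * SPLaguerre.recB (n - 1) t α / SPLaguerre.e n t α ∧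
      SPLaguerre.recA (n - 1) t α
          + SPLaguerre.d n t α * SPLaguerre.recB (n - 1) t α / SPLaguerre.e n t α
        < SPLaguerre.zero n n t α) := by
  open SPLaguerre in
  refine ⟨fun t α ht hα => ?_, fun t α ht hα n hn => ?_, fun n j hj hjn => ?_,
    fun t α ht hα n hn => ?_, fun t α ht hα n hn => ?_⟩
  · have hw := isWeight_weight ht hα
    have hP := isOrthPoly_P hw
    refine ⟨fun n => ⟨(hP n).monic, (hP n).natDegree_eq, ?_⟩, fun j k hjk => ?_, X_mul_P_zero hw,
      fun n hn => ?_⟩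
    · rw [h_eq hw]; exact (hP n).pos_self hw.isStieltjes
    · have := apply_mul_eq_zero_of_ne hP hjk
      rwa [← hw.inner_eq] at this
    · obtain ⟨m, rfl⟩ : ∃ m, n = m + 1 := ⟨n - 1, by omega⟩
      exact X_mul_P_succ hw m
  · have hw := isWeight_weight ht hα
    have hL := hw.isStieltjes
    have hP := isOrthPoly_P hw
    refine ⟨fun z hz => ?_, ?_, fun j hj hjn => ?_, ?_, fun j hj hjn => ?_⟩
    · have him := (hP n).im_eq_zero_of_root hL hz
      have hzre : z = (z.re : ℂ) := Complex.ext (by simp) (by simp [him])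
      have hroot : (P n t α).eval z.re = 0 := by
        rw [hzre, ← Complex.coe_algebraMap, aeval_algebraMap_apply] at hz
        simpa using hz
      obtain ⟨j, hj, hjz⟩ := ((hP n).eval_eq_zero_iff hL).1 hroot
      refine ⟨j, hj, ?_⟩
      rw [hzre, ← hjz]; rfl
    · exact (hP n).eq_nodal hL
    · exact (hP n).strictMonoOn hL ⟨hj, hjn.le⟩ ⟨by omega, by omega⟩ (by omega)
    · exact (hP n).pos_of_root hL (eval_P_zero_eq_zero hw (Finset.mem_Icc.2 ⟨le_rfl, hn⟩))
    · obtain ⟨m, rfl⟩ : ∃ m, n = m + 1 := ⟨n - 1, by omega⟩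
      exact (hP (m + 1)).interlace hL (hP m) hj (by omega)
  · exact ⟨fun t ht α hα α' _ h => zero_lt_zero_of_alpha_lt ht hα h hj hjn,
      fun α hα t ht t' _ h => zero_lt_zero_of_t_lt ht hα h hj hjn⟩
  · have hw := isWeight_weight ht hα
    refine ⟨fun ε hε => ⟨outerLower_le_zero hw hn hε, fun heq => ?_, zero_le_outerUpper hw hn hε,
      fun heq => ?_⟩, zero_between_recA hw hn⟩
    · rw [heq]; exact eq_of_zero_le_outerLower hw hn hε heq.ge
    · rw [← heq]; exact eq_of_outerUpper_le_zero hw hn hε heq.ge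
  · have hw := isWeight_weight ht hα
    exact ⟨(isOrthPoly_P hw n).pos_of_root hw.isStieltjes
      (eval_P_zero_eq_zero hw (Finset.mem_Icc.2 ⟨le_rfl, by omega⟩)),
      zero_between_double_kernel ht hα hn⟩
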